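/- **Model.** There are $m$ resources and $n$ customer types. Type $j$ has revenue $r_j\ge 0$, consumes $a_{ij}\ge 0$ units of resource $i$, and $A_j=(a_{1j},\dots,a_{mj})^\top\neq 0$. In each period one customer arrives, independently of the other periods, of type $j$ with probability $\lambda_j$ ($\sum_j\lambda_j=1$). For $k\in\mathbb N$ the $k$-th system has horizon $T=k\bar T$ and capacities $C=k\bar C$, where $\bar T\in\mathbb N$ and $\bar C_i>0$ are fixed; $r,A,\lambda$ are fixed too. $\Lambda_j(s,t)$ is the number of type-$j$ arrivals in the periods $s,\dots,t$. Assume *general position*: for every $p\in\mathbb R^m$ at most $m$ of the $n+m$ equations $p^\top A_j=r_j$ ($j\in[n]$), $p_i=0$ ($i\in[m]$) hold. **Subroutine $\mathsf{FF}$**, with start time $t_1$, initial capacity $B\in\mathbb R^m$ and horizon length $L$. Put $\bar\alpha_i=\max_{j:a_{ij}\ne0} r_j/a_{ij}$ (and $\bar\alpha_i=0$ if no type uses resource $i$), $\bar\theta=\frac{\max_i B_i}{\min_i B_i}\sum_i\bar\alpha_i$, $D=\bar\theta\sqrt m$, $G=\frac{\max_i B_i}{L}\sqrt m+\sqrt m\,\max_{i,j}a_{ij}$,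 $\theta^{(t_1)}=0$, $B(t_1)=B$. In period $t\ge t_1$, in which a customer of type $j(t)$ arrives: if $a_{ij}>B_i(t)$ for some $i,j$, the subroutine stops for good (and accepts nobody any more). Otherwise it accepts ($y_t=1$) if $r_{j(t)}>\sum_i\theta^{(t)}_ia_{i,j(t)}$ and rejects ($y_t=0$) if not, and it sets $B(t+1)=B(t)-y_tA_{j(t)}$ and $$\theta^{(t+1)}_i=\min\Big(\max\Big(0,\ \theta_i^{(t)}-\tfrac{D}{G\sqrt{t-t_1+1}}\big(\tfrac{B_i}{L}-y_ta_{i,j(t)}\big)\Big),\ \bar\theta\Big).$$ **Algorithm $\mathsf{FD}$, phases I and II.** The parameters satisfy $0<\alpha<\frac12$, $\frac\alpha2\le\beta<\frac12$, $0<\gamma<\frac\alpha2$. Put $a=\alpha$, $b=\frac12+\beta$, $c=\frac\alpha2+\gamma$, $l_1=\lceil T^a\rceil$, $l_2=\lceil T-T^a-T^b\rceil$ ($0$ if negative), $t_1'=l_1+1$, $t_2'=l_1+l_2+1$. In phase I (periods $1,\dots,l_1$) run $\mathsf{FF}$ from period $1$ with initial capacity $\frac{l_1}{T}C$ and horizon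 length $l_1$; let $x_j$ be the number of type-$j$ customers accepted. Put $j$ into $\mathcal R$ if $x_j<\lambda_jT^c$, and otherwise into $\mathcal A$ if $x_j>\lambda_j(T^a-T^c)$. In phase II (periods $t_1',\dots,t_2'-1$), starting with capacity $B(t_1')=\frac{T-l_1}{T}C$, reject the types in $\mathcal R$, accept the types in $\mathcal A$, and for the other types follow the decisions of $\mathsf{FF}$, which is run as a subroutine on all arrivals from period $t_1'$ on, with its own virtual capacity, initially $\frac{T-l_1}{T}C$, and horizon length $T-l_1$. Let $\bar x_j(t_1',t_2'-1)$ be the number of type-$j$ customers accepted in phase II if one may go over the real capacity limits (the virtual capacity of the subroutine is still enforced). Let $\bar z(t_1')$ be an optimal solution of $$\max\Big\{\sum_j r_jz_j \ :\ \sum_jA_jz_j\le B(t_1'),\ 0\le z_j\le\Lambda_j(t_1',T)\ \ \forall j\Big\},$$ and let $E$ be the event that, for all $j\in[n]$, $$\bar x_j(t_1',t_2'-1)\ \le\ \bar z_j(t_1')\ \le\ \bar x_j(t_1',t_2'-1)+\Lambda_j(t_2',T).$$ **Claim.** Let $0<\varepsilon<2\gamma$ and $\varepsilon\ge\frac{\log\log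 T}{\log T}$ for all large $k$. Then, as $k\to\infty$, $$P(E^{\complement})=O\big(e^{-T^{\varepsilon}}\big).$$ Here $\alpha,\beta,\gamma,\varepsilon$ may be constants, or more generally may depend on $k$, provided that they satisfy the above conditions for all large $k$ and that $T^{2\gamma-\varepsilon}\to\infty$ and $T^{\alpha-2\gamma}\to\infty$ (which is automatic for constants). -/

import Mathlib

open Filter MeasureTheory ProbabilityTheory Asymptotics
open scoped Matrix

namespace NRM

noncomputable section

/-! ### Arrivals and linear programs

There are `n` customer types and `m` resources. Type `j` brings revenue `r j` and consumes
`A i j` units of resource `i`. A sample path is a sequence `X : ℕ → Fin n`; the customer of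
period `t = 1, 2, …` has type `X t`. -/

/-- `Λ_j(s, t)`: the number of type-`j` arrivals during the periods `s, …, t`. -/
def arrivals {n : ℕ} (X : ℕ → Fin n) (s t : ℕ) (j : Fin n) : ℕ :=
  ((Finset.Icc s t).filter (fun u => X u = j)).card

/-- The feasible set of the packing program with capacities `b` and upper bounds `v`:
`∑ j, A_j z_j ≤ b` and `0 ≤ z ≤ v`. -/
def lpFeasible {m n : ℕ} (A : Matrix (Fin m) (Fin n) ℝ) (b : Fin m → ℝ) (v : Fin n → ℝ) :
    Set (Fin n → ℝ) :=
  {z | (∀ i, ∑ j, A i j * z j ≤ b i) ∧ ∀ j, 0 ≤ z j ∧ z j ≤ v j}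

/-- `z` is an optimal solution of `max {∑ j, r_j z_j | A z ≤ b, 0 ≤ z ≤ v}`. -/
def IsLPOptimal {m n : ℕ} (r : Fin n → ℝ) (A : Matrix (Fin m) (Fin n) ℝ) (b : Fin m → ℝ)
    (v : Fin n → ℝ) (z : Fin n → ℝ) : Prop :=
  z ∈ lpFeasible A b v ∧ IsMaxOn (fun z' => ∑ j, r j * z' j) (lpFeasible A b v) z

/-- General position: for every price vector `p`, at most `m` of the `n + m` columns `l` of
`Ā = [A, I]` satisfy `pᵀ Ā_l = r̄_l`, where `r̄ = (r, 0)`. -/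
def GeneralPosition {m n : ℕ} (r : Fin n → ℝ) (A : Matrix (Fin m) (Fin n) ℝ) : Prop :=
  ∀ p : Fin m → ℝ,
    {l : Fin n ⊕ Fin m |
      (p ᵥ* Matrix.fromCols A (1 : Matrix (Fin m) (Fin m) ℝ)) l
        = Sum.elim r (fun _ => (0 : ℝ)) l}.ncard ≤ m

/-! ### The primal-dual subroutine `FF` -/

/-- `ᾱ_i = max {r_j / a_ij | a_ij ≠ 0}`; it is `0` for a resource that no type uses. -/
def alphaBar {m n : ℕ} (r : Fin n → ℝ) (A : Matrix (Fin m) (Fin n) ℝ) (i : Fin m) : ℝ :=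
  ⨆ j : {j : Fin n // A i j ≠ 0}, r j / A i j

/-- `ā = max_{i,j} a_ij`. -/
def aBar {m n : ℕ} (A : Matrix (Fin m) (Fin n) ℝ) : ℝ := ⨆ i, ⨆ j, A i j

/-- `θ̄ = (B_max / B_min) ∑ i, ᾱ_i`. -/
def thetaBar {m n : ℕ} (r : Fin n → ℝ) (A : Matrix (Fin m) (Fin n) ℝ) (B : Fin m → ℝ) : ℝ :=
  (⨆ i, B i) / (⨅ i, B i) * ∑ i, alphaBar r A i

/-- The diameter bound `D = θ̄ √m` of the price box `[0, θ̄]^m`. -/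
def diamBound {m n : ℕ} (r : Fin n → ℝ) (A : Matrix (Fin m) (Fin n) ℝ) (B : Fin m → ℝ) : ℝ :=
  thetaBar r A B * Real.sqrt m

/-- The gradient bound `G = (B_max / L) √m + ā √m`. -/
def gradBound {m n : ℕ} (A : Matrix (Fin m) (Fin n) ℝ) (B : Fin m → ℝ) (L : ℝ) : ℝ :=
  (⨆ i, B i) / L * Real.sqrt m + aBar A * Real.sqrt m

/-- Bid prices and remaining capacities at the beginning of a period. -/
structure FFState (m : ℕ) where
  /-- the bid prices `θ` -/
  price : Fin m → ℝ
  /-- the remaining capacities -/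
  cap : Fin m → ℝ

/-- The capacities `b` suffice for every customer type: `A_j ≤ b` for all `j`. -/
def Sufficient {m n : ℕ} (A : Matrix (Fin m) (Fin n) ℝ) (b : Fin m → ℝ) : Prop :=
  ∀ j i, A i j ≤ b i

/-- In state `s`, `FF` accepts an arriving customer of type `j`: the capacities are sufficient
and `r_j > ∑ i, θ_i a_ij`. -/
def ffAcceptsIn {m n : ℕ} (r : Fin n → ℝ) (A : Matrix (Fin m) (Fin n) ℝ) (s : FFState m)
    (j : Fin n) : Prop :=
  Sufficient A s.cap ∧ ∑ i, s.price i * A i j < r j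

open Classical in
/-- One period of `FF` with initial capacity `B` on a horizon of length `L`: the `u`-th period
since the start, in which a customer of type `j` arrives. With `y ∈ {0, 1}` the decision, the
capacities drop by `y A_j`, and the prices make a projected gradient step of size
`η = D / (G √u)` on `g(θ) = ∑ i, θ_i (B_i / L - y a_ij)`. Once the capacities are insufficient
the procedure has stopped: the state is frozen (so they stay insufficient). -/
def ffStep {m n : ℕ} (r : Fin n → ℝ) (A : Matrix (Fin m) (Fin n) ℝ) (B : Fin m → ℝ) (L : ℝ)
    (u : ℕ) (s : FFState m) (j : Fin n) : FFState m :=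
  let y : ℝ := if ffAcceptsIn r A s j then 1 else 0
  let η : ℝ := diamBound r A B / (gradBound A B L * Real.sqrt u)
  if Sufficient A s.cap then
    { price := fun i => min (max 0 (s.price i - η * (B i / L - y * A i j))) (thetaBar r A B)
      cap := fun i => s.cap i - y * A i j }
  else s

/-- The state of `FF`, started in period `t₁` with zero prices and capacity `B`, at the
beginning of period `t₁ + u`. -/
def ffState {m n : ℕ} (r : Fin n → ℝ) (A : Matrix (Fin m) (Fin n) ℝ) (B : Fin m → ℝ) (L : ℝ)
    (t₁ : ℕ) (X : ℕ → Fin n) : ℕ → FFState m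
  | 0 => { price := fun _ => 0, cap := B }
  | u + 1 => ffStep r A B L (u + 1) (ffState r A B L t₁ X u) (X (t₁ + u))

/-- `FF`, started in period `t₁`, accepts the customer of period `t ≥ t₁` (that is, it has not
stopped before period `t`, and `y_t = 1`). -/
def ffAccepts {m n : ℕ} (r : Fin n → ℝ) (A : Matrix (Fin m) (Fin n) ℝ) (B : Fin m → ℝ) (L : ℝ)
    (t₁ : ℕ) (X : ℕ → Fin n) (t : ℕ) : Prop :=
  ffAcceptsIn r A (ffState r A B L t₁ X (t - t₁)) (X t)

/-! ### Phases I and II of algorithm `FD`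

`T` is the horizon, `C` the vector of initial capacities, and `α, β, γ` are the parameters of
the algorithm; `a = α`, `b = 1/2 + β` and `c = α/2 + γ`. -/

/-- The length `l₁ = ⌈T^a⌉` of phase I. -/
def len1 (T : ℕ) (α : ℝ) : ℕ := ⌈(T : ℝ) ^ α⌉₊

/-- The length `l₂ = ⌈T - T^a - T^b⌉` of phase II (`0` if this is negative). -/
def len2 (T : ℕ) (α β : ℝ) : ℕ := ⌈(T : ℝ) - (T : ℝ) ^ α - (T : ℝ) ^ (1 / 2 + β)⌉₊

/-- The first period `t₁' = l₁ + 1` of phase II. -/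
def start2 (T : ℕ) (α : ℝ) : ℕ := len1 T α + 1

/-- The first period `t₂' = l₁ + l₂ + 1` of phase III. -/
def start3 (T : ℕ) (α β : ℝ) : ℕ := len1 T α + len2 T α β + 1

open Classical in
/-- `x_j(1, t₁' - 1)`: the number of type-`j` customers accepted in phase I, in which `FF` runs
on the periods `1, …, l₁` with initial capacity `C l₁ / T`, the share of a horizon of
length `l₁`. -/
def phase1Count {m n : ℕ} (r : Fin n → ℝ) (A : Matrix (Fin m) (Fin n) ℝ) (C : Fin m → ℝ)
    (T : ℕ) (α : ℝ) (X : ℕ → Fin n) (j : Fin n) : ℕ :=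
  ((Finset.Icc 1 (len1 T α)).filter (fun t => X t = j ∧
    ffAccepts r A (fun i => C i * ((len1 T α : ℝ) / T)) (len1 T α) 1 X t)).card

/-- Type `j` is put into the class `𝓡` (reject) at the end of phase I. -/
def InReject {m n : ℕ} (r : Fin n → ℝ) (A : Matrix (Fin m) (Fin n) ℝ) (lam : Fin n → ℝ)
    (C : Fin m → ℝ) (T : ℕ) (α γ : ℝ) (X : ℕ → Fin n) (j : Fin n) : Prop :=
  (phase1Count r A C T α X j : ℝ) < lam j * (T : ℝ) ^ (α / 2 + γ)

/-- Type `j` is put into the class `𝓐` (accept) at the end of phase I. -/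
def InAccept {m n : ℕ} (r : Fin n → ℝ) (A : Matrix (Fin m) (Fin n) ℝ) (lam : Fin n → ℝ)
    (C : Fin m → ℝ) (T : ℕ) (α γ : ℝ) (X : ℕ → Fin n) (j : Fin n) : Prop :=
  ¬ InReject r A lam C T α γ X j ∧
    lam j * ((T : ℝ) ^ α - (T : ℝ) ^ (α / 2 + γ)) < (phase1Count r A C T α X j : ℝ)

/-- The capacity `B(t₁') = C (T - l₁) / T` with which phase II starts. -/
def phase2Capacity {m : ℕ} (C : Fin m → ℝ) (T : ℕ) (α : ℝ) (i : Fin m) : ℝ :=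
  C i * (((T : ℝ) - len1 T α) / T)

/-- The decision of phase II in period `t` when the real capacities are not enforced: types in
`𝓡` are rejected, types in `𝓐` are accepted, and the other types follow the `FF` subroutine.
The subroutine runs from period `t₁'` on, on every arriving customer, with its own virtual
capacity, which is initially `C (T - l₁) / T` for the remaining horizon of length `T - l₁`; once
that virtual capacity is insufficient, the subroutine stops and accepts nobody. -/
def phase2AcceptsUncapped {m n : ℕ} (r : Fin n → ℝ) (A : Matrix (Fin m) (Fin n) ℝ)
    (lam : Fin n → ℝ) (C : Fin m → ℝ) (T : ℕ) (α γ : ℝ) (X : ℕ → Fin n) (t : ℕ) : Prop :=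
  ¬ InReject r A lam C T α γ X (X t) ∧
    (InAccept r A lam C T α γ X (X t) ∨
      ffAccepts r A (phase2Capacity C T α) ((T : ℝ) - len1 T α) (start2 T α) X t)

open Classical in
/-- `x̄_j(t₁', t₂' - 1)`: the number of type-`j` customers accepted in phase II if the real
capacity limits may be exceeded. -/
def phase2CountUncapped {m n : ℕ} (r : Fin n → ℝ) (A : Matrix (Fin m) (Fin n) ℝ)
    (lam : Fin n → ℝ) (C : Fin m → ℝ) (T : ℕ) (α β γ : ℝ) (X : ℕ → Fin n) (j : Fin n) : ℕ :=
  ((Finset.Icc (start2 T α) (start3 T α β - 1)).filter (fun t => X t = j ∧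
    phase2AcceptsUncapped r A lam C T α γ X t)).card

/-- `z` is an optimal solution of the hindsight program `HO(t₁')`: capacities `B(t₁')` and
upper bounds `Λ_j(t₁', T)`. -/
def IsHindsightOptimal {m n : ℕ} (r : Fin n → ℝ) (A : Matrix (Fin m) (Fin n) ℝ) (C : Fin m → ℝ)
    (T : ℕ) (α : ℝ) (X : ℕ → Fin n) (z : Fin n → ℝ) : Prop :=
  IsLPOptimal r A (phase2Capacity C T α) (fun j => (arrivals X (start2 T α) T j : ℝ)) z

/-- The condition defining the event `E`, on the sample path `X` with the hindsight solution
`z`: for every type `j`, `x̄_j(t₁', t₂' - 1) ≤ z_j ≤ x̄_j(t₁', t₂' - 1) + Λ_j(t₂', T)`. -/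
def GoodPath {m n : ℕ} (r : Fin n → ℝ) (A : Matrix (Fin m) (Fin n) ℝ) (lam : Fin n → ℝ)
    (C : Fin m → ℝ) (T : ℕ) (α β γ : ℝ) (X : ℕ → Fin n) (z : Fin n → ℝ) : Prop :=
  ∀ j, (phase2CountUncapped r A lam C T α β γ X j : ℝ) ≤ z j ∧
    z j ≤ phase2CountUncapped r A lam C T α β γ X j + arrivals X (start3 T α β) T j

end

end NRM

/-! ### General position: tight columns and a sharp linear bound -/

namespace NRM

variable {m n : ℕ} {r : Fin n → ℝ} {A : Matrix (Fin m) (Fin n) ℝ}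

/-! Everything is compared with one fluid program: maximise `r ξ` subject to `A ξ ≤ b`, `0 ≤ ξ ≤
lam`, where `b = Cbar / Tbar` is the capacity per period. Both runs of `FF` and the hindsight
program are scaled, noisy copies of it. Let `p`, `ξ` be optimal dual and primal solutions
(`exists_fluidPair`, a saddle point of the Lagrangian). In general position the columns of `[A, I]`
that are tight at `p` are linearly independent, so a direction is controlled linearly by how much it
violates complementary slackness with `p` (`GeneralPosition.exists_bound`). Hence near-optimality
implies closeness to `ξ`.

This is applied twice on a sample path whose noise is at most `δ`. The hindsight solution over a
length `L` is within `O(δ)` of `L ξ` (`FluidPair.exists_hindsight_bound`). For `FF`, the regret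
bound of projected gradient descent holds against every fixed price vector; varying one coordinate
of the comparator around `p` gives approximate complementary slackness, so the acceptance counts
over `N` periods are within `O(δ)` of `N ξ` (`FluidPair.exists_ff_bound`). This needs `p` strictly
below the price cap `θ̄`. If `p` reaches the cap, a single resource and a single served type remain;
`FF` may then run ahead of the fluid rate, but its virtual capacity keeps it below `L ξ`, which the
hindsight solution attains (`SingleType`).

With phase I noise of order `T^(α/2+ε/2)`, below the threshold `T^(α/2+γ)`, membership in the reject
class means `ξ_j = 0` and membership in the accept class means `ξ_j = lam_j`, whenever `lam_j > 0`.
Phase III has length at least of order `T^(1/2+γ)`, which dominates the noise `T^(1/2+ε/2)` of the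
remaining horizon, so every `z_j` lies in the required window (`FluidPair.exists_goodPath`).

The noise consists of sums of bounded martingale differences, and Azuma–Hoeffding at these scales
bounds the exceptional probability by a constant times `exp(-T^ε)` (`measure_not_ffQuiet_le`,
`measure_not_arrivals_le`). -/

/-- The reduced revenue `r_j - ∑ i, p_i a_ij` of type `j` at the prices `p`. -/
def redCost (r : Fin n → ℝ) (A : Matrix (Fin m) (Fin n) ℝ) (p : Fin m → ℝ) (j : Fin n) : ℝ :=
  r j - ∑ i, p i * A i j

/-- The columns of `[A, I]` that are tight at the prices `p`. -/
def tightSet (r : Fin n → ℝ) (A : Matrix (Fin m) (Fin n) ℝ) (p : Fin m → ℝ) :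
    Set (Fin n ⊕ Fin m) :=
  {l | (p ᵥ* Matrix.fromCols A (1 : Matrix (Fin m) (Fin m) ℝ)) l
        = Sum.elim r (fun _ => (0 : ℝ)) l}

theorem inl_mem_tightSet {p : Fin m → ℝ} {j : Fin n} :
    Sum.inl j ∈ tightSet r A p ↔ redCost r A p j = 0 := by
  rw [redCost, sub_eq_zero, eq_comm]
  rfl

theorem inr_mem_tightSet {p : Fin m → ℝ} {i : Fin m} :
    Sum.inr i ∈ tightSet r A p ↔ p i = 0 := by
  simp [tightSet, Matrix.vecMul_fromCols]

/-- The column `l` of `[A, I]`. -/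
def extCol (A : Matrix (Fin m) (Fin n) ℝ) (l : Fin n ⊕ Fin m) : Fin m → ℝ :=
  fun i => Matrix.fromCols A (1 : Matrix (Fin m) (Fin m) ℝ) i l

theorem GeneralPosition.ncard_le (h : GeneralPosition r A) (p : Fin m → ℝ) :
    (tightSet r A p).ncard ≤ m := h p

/-- At `p = 0` all `m` unit columns are already tight, so no type can be tight as well. -/
theorem GeneralPosition.pos (h : GeneralPosition r A) (hr : ∀ j, 0 ≤ r j) (j : Fin n) :
    0 < r j := by
  refine lt_of_le_of_ne (hr j) fun h0 => ?_
  have h1 := h.ncard_le 0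
  have h2 : insert (Sum.inl j) (Set.range Sum.inr) ⊆ tightSet r A 0 := by
    rintro l (rfl | ⟨i, rfl⟩)
    · rw [inl_mem_tightSet]; simp [redCost, ← h0]
    · rw [inr_mem_tightSet]; rfl
  have h3 := Set.ncard_le_ncard h2 (Set.toFinite _)
  rw [Set.ncard_insert_of_notMem (by simp) (Set.toFinite _)] at h3
  have h4 : (Set.range (Sum.inr : Fin m → Fin n ⊕ Fin m)).ncard = m := by
    rw [← Set.image_univ, Set.ncard_image_of_injective _ Sum.inr_injective, Set.ncard_univ]
    simp
  omega

/-- If the tight columns do not span, the prices can be moved until one more column is tight. -/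
theorem exists_tightSet_ssubset (p : Fin m → ℝ)
    (h : Submodule.span ℝ (extCol A '' tightSet r A p) ≠ ⊤) :
    ∃ p', tightSet r A p ⊂ tightSet r A p' := by
  obtain ⟨f, hf, hle⟩ := Submodule.exists_le_ker_of_lt_top _ (lt_top_iff_ne_top.2 h)
  set d : Fin m → ℝ := fun i => f (Pi.single i 1) with hd
  have hfd : ∀ v, f v = ∑ i, d i * v i := by
    intro v
    conv_lhs => rw [← Finset.univ_sum_single v]
    rw [map_sum]
    refine Finset.sum_congr rfl fun i _ => ?_
    have : (Pi.single i (v i) : Fin m → ℝ) = v i • Pi.single i 1 := by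
      rw [← Pi.single_smul]; simp
    rw [this, map_smul, smul_eq_mul, mul_comm]
  obtain ⟨i, hi⟩ : ∃ i, d i ≠ 0 := by
    by_contra! hc
    exact hf (LinearMap.ext fun v => by rw [hfd]; simp [hc])
  have hker : ∀ l ∈ tightSet r A p, ∑ i, d i * extCol A l i = 0 := fun l hl => by
    rw [← hfd]; exact hle (Submodule.subset_span ⟨l, hl, rfl⟩)
  -- Moving along `d` keeps every tight column tight. The step makes the `i`-th price vanish, so the
  -- `i`-th unit column becomes tight; it was not tight before because `d i ≠ 0`.
  refine ⟨fun k => p k - p i / d i * d k, fun l hl => ?_, fun hsub => ?_⟩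
  · have h1 := hker l hl
    have h2 : (∑ k, p k * extCol A l k) = Sum.elim r (fun _ => (0 : ℝ)) l := hl
    change (∑ k, (p k - p i / d i * d k) * extCol A l k) = _
    rw [← h2, ← sub_eq_zero, ← Finset.sum_sub_distrib]
    calc _ = ∑ k, -(p i / d i) * (d k * extCol A l k) :=
          Finset.sum_congr rfl fun k _ => by ring
      _ = 0 := by rw [← Finset.mul_sum, h1, mul_zero]
  · have h3 : Sum.inr i ∈ tightSet r A (fun k => p k - p i / d i * d k) := by
      rw [inr_mem_tightSet]; field_simp; ring
    have h4 := hker _ (hsub h3)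
    simp [extCol, Matrix.one_apply] at h4
    exact hi h4

/-- As long as the tight columns do not span, the tight set can be enlarged; at most `m` columns can
be tight, so this ends. The spanning set reached has at most `m` elements in dimension `m`, hence is
a basis, which gives independence of every smaller tight set. -/
theorem GeneralPosition.exists_span (h : GeneralPosition r A) (p : Fin m → ℝ) :
    ∃ p', tightSet r A p ⊆ tightSet r A p' ∧
      Submodule.span ℝ (extCol A '' tightSet r A p') = ⊤ := by
  by_contra! hc
  have key : ∀ k : ℕ, ∃ p', tightSet r A p ⊆ tightSet r A p' ∧ k ≤ (tightSet r A p').ncard := by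
    intro k
    induction k with
    | zero => exact ⟨p, subset_rfl, Nat.zero_le _⟩
    | succ k ih =>
      obtain ⟨q, hq, hk⟩ := ih
      obtain ⟨q', hq'⟩ := exists_tightSet_ssubset q (hc q hq)
      exact ⟨q', hq.trans hq'.subset, hk.trans_lt (Set.ncard_lt_ncard hq' (Set.toFinite _))⟩
  obtain ⟨q, -, hq⟩ := key (m + 1)
  have := h.ncard_le q
  omega

/-- In general position, the tight columns of `[A, I]` are linearly independent. -/
theorem GeneralPosition.linearIndependent (h : GeneralPosition r A) (p : Fin m → ℝ) :
    LinearIndependent ℝ (fun l : tightSet r A p => extCol A l) := by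
  obtain ⟨q, hq, hspan⟩ := h.exists_span p
  have h1 : LinearIndependent ℝ (fun l : tightSet r A q => extCol A l) := by
    classical
    have : Fintype (tightSet r A q) := Fintype.ofFinite _
    rw [linearIndependent_iff_card_le_finrank_span, Set.finrank]
    have h2 : Set.range (fun l : tightSet r A q => extCol A l) = extCol A '' tightSet r A q := by
      rw [Set.image_eq_range]
    rw [h2, hspan, finrank_top, Module.finrank_fin_fun, ← Nat.card_eq_fintype_card]
    exact h.ncard_le q
  exact h1.comp (Set.inclusion hq) (Set.inclusion_injective hq)

/-- Sharpness of the primal solution: a direction `w` is controlled by its reduced costs and its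
priced consumptions. -/
theorem GeneralPosition.exists_bound (h : GeneralPosition r A) (p : Fin m → ℝ) :
    ∃ K : ℝ, 0 < K ∧ ∀ (w : Fin n → ℝ) (δ : ℝ), 0 ≤ δ → (∀ j, |redCost r A p j * w j| ≤ δ) →
      (∀ i, |p i * ∑ j, A i j * w j| ≤ δ) → ∀ j, |w j| ≤ K * δ := by
  let Φ : (Fin n → ℝ) →ₗ[ℝ] (Fin n → ℝ) × (Fin m → ℝ) :=
    { toFun := fun w => (fun j => redCost r A p j * w j, fun i => p i * ∑ j, A i j * w j)
      map_add' := fun v w => by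
        ext <;> simp [mul_add, Finset.sum_add_distrib]
      map_smul' := fun c w => by
        ext i
        · simp; ring
        · simp only [Pi.smul_apply, smul_eq_mul, RingHom.id_apply, Prod.smul_snd, Finset.mul_sum]
          exact Finset.sum_congr rfl fun j _ => by ring }
  have hker : LinearMap.ker Φ = ⊥ := by
    rw [LinearMap.ker_eq_bot']
    intro w hw
    have hw1 : ∀ j, redCost r A p j * w j = 0 := fun j => congrFun (congrArg Prod.fst hw) j
    have hw2 : ∀ i, p i * ∑ j, A i j * w j = 0 := fun i => congrFun (congrArg Prod.snd hw) i
    classical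
    have : Fintype (tightSet r A p) := Fintype.ofFinite _
    -- A kernel vector `w` together with its slacks `-A w` is a linear relation between the columns
    -- of `[A, I]`, supported on the tight ones.
    let g : Fin n ⊕ Fin m → ℝ := Sum.elim w (fun i => -∑ j, A i j * w j)
    have hg0 : ∀ l, l ∉ tightSet r A p → g l = 0 := by
      rintro (j | i) hl
      · rw [inl_mem_tightSet] at hl
        exact (mul_eq_zero.1 (hw1 j)).resolve_left hl
      · rw [inr_mem_tightSet] at hl
        simp [g, (mul_eq_zero.1 (hw2 i)).resolve_left hl]
    have hsum : ∑ l : tightSet r A p, g l • extCol A l = 0 := by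
      have h1 : ∑ l : tightSet r A p, g l • extCol A l = ∑ l, g l • extCol A l := by
        rw [Finset.sum_set_coe (tightSet r A p) (f := fun l => g l • extCol A l)]
        refine Finset.sum_subset (Finset.subset_univ _) fun l _ hl => ?_
        rw [hg0 l (by simpa using hl), zero_smul]
      rw [h1]
      ext i
      simp [g, extCol, Matrix.one_apply, Finset.sum_apply, mul_comm]
    have h2 := Fintype.linearIndependent_iff.1 (h.linearIndependent p) (fun l => g l) hsum
    ext j
    by_cases hj : Sum.inl j ∈ tightSet r A p
    · exact h2 ⟨_, hj⟩
    · exact hg0 _ hj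
  obtain ⟨K, hK, hanti⟩ := Φ.exists_antilipschitzWith hker
  refine ⟨K, by exact_mod_cast hK, fun w δ hδ h1 h2 j => ?_⟩
  have h3 := hanti.le_mul_dist w 0
  rw [dist_zero_right, map_zero, dist_zero_right] at h3
  refine (norm_le_pi_norm w j).trans (h3.trans ?_)
  gcongr
  rw [Prod.norm_def]
  exact max_le ((pi_norm_le_iff_of_nonneg hδ).2 h1) ((pi_norm_le_iff_of_nonneg hδ).2 h2)

end NRM

/-! ### The fluid program, its dual prices, and stability of the hindsight solution -/

namespace NRM

variable {m n : ℕ} {r : Fin n → ℝ} {A : Matrix (Fin m) (Fin n) ℝ} {lam : Fin n → ℝ}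
  {b p : Fin m → ℝ} {ξ : Fin n → ℝ}

theorem alphaBar_nonneg (hr : ∀ j, 0 ≤ r j) (hA : ∀ i j, 0 ≤ A i j) (i : Fin m) :
    0 ≤ alphaBar r A i :=
  Real.iSup_nonneg fun j => div_nonneg (hr j) (hA i j)

theorem le_alphaBar_mul (hA : ∀ i j, 0 ≤ A i j) {i : Fin m} {j : Fin n} (h : A i j ≠ 0) :
    r j ≤ alphaBar r A i * A i j := by
  have h1 : r j / A i j ≤ alphaBar r A i :=
    le_ciSup (f := fun j : {j : Fin n // A i j ≠ 0} => r j / A i j) (Set.finite_range _).bddAbove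
      ⟨j, h⟩
  exact (div_le_iff₀ (lt_of_le_of_ne (hA i j) (Ne.symm h))).1 h1

theorem alphaBar_pos (hr : ∀ j, 0 < r j) (hA : ∀ i j, 0 ≤ A i j) {i : Fin m} {j : Fin n}
    (h : A i j ≠ 0) : 0 < alphaBar r A i := by
  have h1 := le_alphaBar_mul (r := r) hA h
  by_contra! hc
  exact absurd (hr j) (not_lt.2 (h1.trans (mul_nonpos_of_nonpos_of_nonneg hc (hA i j))))

theorem sum_redCost_mul (p : Fin m → ℝ) (w : Fin n → ℝ) :
    ∑ j, r j * w j = ∑ j, redCost r A p j * w j + ∑ i, p i * ∑ j, A i j * w j := by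
  simp only [redCost, sub_mul, Finset.sum_sub_distrib, Finset.sum_mul, Finset.mul_sum]
  rw [Finset.sum_comm (f := fun i j => p i * (A i j * w j))]
  simp [mul_assoc]

/-- `ξ` and `p` are optimal for the fluid program `max {r ξ | A ξ ≤ b, 0 ≤ ξ ≤ lam}` and its dual,
as witnessed by complementary slackness. -/
structure FluidPair (r : Fin n → ℝ) (A : Matrix (Fin m) (Fin n) ℝ) (lam : Fin n → ℝ)
    (b : Fin m → ℝ) (p : Fin m → ℝ) (ξ : Fin n → ℝ) : Prop where
  price_nonneg : ∀ i, 0 ≤ p i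
  price_le : ∀ i, p i ≤ alphaBar r A i
  nonneg : ∀ j, 0 ≤ ξ j
  le : ∀ j, ξ j ≤ lam j
  eq_of_pos : ∀ j, 0 < redCost r A p j → ξ j = lam j
  eq_of_neg : ∀ j, redCost r A p j < 0 → ξ j = 0
  feasible : ∀ i, ∑ j, A i j * ξ j ≤ b i
  slack : ∀ i, p i * (b i - ∑ j, A i j * ξ j) = 0

theorem sum_comb_mul {ι : Type*} [Fintype ι] (s t : ℝ) (x y c : ι → ℝ) :
    ∑ i, (s * x i + t * y i) * c i = s * ∑ i, x i * c i + t * ∑ i, y i * c i := by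
  rw [Finset.mul_sum, Finset.mul_sum, ← Finset.sum_add_distrib]
  exact Finset.sum_congr rfl fun i _ => by ring

theorem exists_fluidPair (hr : ∀ j, 0 ≤ r j) (hA : ∀ i j, 0 ≤ A i j) (hlam : ∀ j, 0 ≤ lam j)
    (hb : ∀ i, 0 < b i) : ∃ p ξ, FluidPair r A lam b p ξ := by
  let f : (Fin m → ℝ) → (Fin n → ℝ) → ℝ := fun p z =>
    ∑ j, r j * z j + ∑ i, p i * (b i - ∑ j, A i j * z j)
  have hf2 : ∀ p z, f p z = ∑ j, redCost r A p j * z j + ∑ i, p i * b i := by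
    intro p z
    change ∑ j, r j * z j + ∑ i, p i * (b i - ∑ j, A i j * z j) = _
    rw [sum_redCost_mul (A := A) p z]
    simp only [mul_sub, Finset.sum_sub_distrib]
    ring
  have hα := alphaBar_nonneg hr hA
  have hcont1 : ∀ z, Continuous fun p => f p z := fun z => by fun_prop
  have hcont2 : ∀ p, Continuous fun z => f p z := fun p => by fun_prop
  -- The minimax theorem needs a compact price box. The margin `+ 1` above `alphaBar` ensures that
  -- the upper price bound is never active, so the saddle point is one for unrestricted prices.
  obtain ⟨p, hp, ξ, hξ, hs⟩ := Sion.exists_isSaddlePointOn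
    (X := Set.Icc (0 : Fin m → ℝ) (fun i => alphaBar r A i + 1))
    (Y := Set.Icc (0 : Fin n → ℝ) lam) (f := f)
    ⟨0, le_rfl, fun i => by simpa using (hα i).trans (by linarith)⟩ (convex_Icc _ _) isCompact_Icc
    (fun z _ => (hcont1 z).lowerSemicontinuous.lowerSemicontinuousOn _)
    (fun z _ => ConvexOn.quasiconvexOn ⟨convex_Icc _ _, fun x _ y _ s t _ _ hst => le_of_eq (by
      have h1 := sum_comb_mul s t x y fun i => b i - ∑ j, A i j * z j
      simp only [f, Pi.add_apply, Pi.smul_apply, smul_eq_mul, h1]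
      linear_combination (-∑ j, r j * z j) * hst)⟩)
    (convex_Icc _ _) ⟨0, le_rfl, fun j => hlam j⟩ isCompact_Icc
    (fun q _ => (hcont2 q).upperSemicontinuous.upperSemicontinuousOn _)
    (fun q _ => ConcaveOn.quasiconcaveOn ⟨convex_Icc _ _, fun x _ y _ s t _ _ hst => le_of_eq (by
      have h1 : ∑ j, redCost r A q j * (s * x j + t * y j) = s * ∑ j, redCost r A q j * x j +
          t * ∑ j, redCost r A q j * y j := by
        simpa only [mul_comm] using sum_comb_mul s t x y (redCost r A q)
      simp only [hf2, Pi.add_apply, Pi.smul_apply, smul_eq_mul, h1]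
      linear_combination (∑ i, q i * b i) * hst)⟩)
  have hp0 : ∀ i, 0 ≤ p i := fun i => hp.1 i
  have hp1 : ∀ i, p i ≤ alphaBar r A i + 1 := fun i => hp.2 i
  have hξ0 : ∀ j, 0 ≤ ξ j := fun j => hξ.1 j
  have hξ1 : ∀ j, ξ j ≤ lam j := fun j => hξ.2 j
  have hz : ∀ j t, 0 ≤ t → t ≤ lam j → redCost r A p j * (t - ξ j) ≤ 0 := by
    intro j t ht0 ht1
    have h1 := hs p hp (ξ + Pi.single j (t - ξ j)) ⟨fun k => ?_, fun k => ?_⟩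
    · simp only [hf2, Pi.add_apply, mul_add, Finset.sum_add_distrib, Pi.single_apply, mul_ite,
        mul_zero, Finset.sum_ite_eq', Finset.mem_univ, if_true] at h1
      linarith
    all_goals
      by_cases hk : k = j
      · subst hk; simpa
      · simpa [hk] using by first | exact hξ0 k | exact hξ1 k
  have hq : ∀ i q, 0 ≤ q → q ≤ alphaBar r A i + 1 →
      0 ≤ (q - p i) * (b i - ∑ j, A i j * ξ j) := by
    intro i q hq0 hq1
    have h1 := hs (p + Pi.single i (q - p i)) ⟨fun k => ?_, fun k => ?_⟩ ξ hξ
    · simp only [f, Pi.add_apply, add_mul, Finset.sum_add_distrib, Pi.single_apply, ite_mul,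
        zero_mul, Finset.sum_ite_eq', Finset.mem_univ, if_true] at h1
      linarith
    all_goals
      by_cases hk : k = i
      · subst hk; simpa
      · simpa [hk] using by first | exact hp0 k | exact hp1 k
  have hneg : ∀ j, redCost r A p j < 0 → ξ j = 0 := fun j hj => by
    have := hz j 0 le_rfl (hlam j)
    have := hξ0 j
    nlinarith
  -- At a price above `alphaBar` every user of the resource has negative reduced revenue and is not
  -- served; the resource is then idle, and lowering its price would decrease the Lagrangian.
  have hple : ∀ i, p i ≤ alphaBar r A i := by
    intro i
    by_contra! hc
    have h0 : ∑ j, A i j * ξ j = 0 := Finset.sum_eq_zero fun j _ => by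
      by_cases hj : A i j = 0
      · rw [hj, zero_mul]
      · rw [hneg j, mul_zero]
        have h1 := le_alphaBar_mul (r := r) hA hj
        have h2 : p i * A i j ≤ ∑ i, p i * A i j := Finset.single_le_sum
          (f := fun i => p i * A i j) (fun i _ => mul_nonneg (hp0 i) (hA i j)) (Finset.mem_univ i)
        have h3 := mul_lt_mul_of_pos_right hc (lt_of_le_of_ne (hA i j) (Ne.symm hj))
        rw [redCost]; linarith
    have h1 := hq i 0 le_rfl ((hα i).trans (by linarith))
    rw [h0] at h1
    nlinarith [hb i, hα i]
  have hfeas : ∀ i, ∑ j, A i j * ξ j ≤ b i := fun i => by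
    have h1 := hq i (alphaBar r A i + 1) ((hα i).trans (by linarith)) le_rfl
    have h2 := hple i
    by_contra! hc
    nlinarith
  refine ⟨p, ξ, hp0, hple, hξ0, hξ1, fun j hj => ?_, hneg, hfeas, fun i => ?_⟩
  · have := hz j (lam j) (hlam j) le_rfl
    have := hξ1 j
    nlinarith
  · have h1 := hq i 0 le_rfl ((hα i).trans (by linarith))
    have := mul_nonneg (hp0 i) (sub_nonneg.2 (hfeas i))
    linarith

theorem FluidPair.redCost_mul_le (h : FluidPair r A lam b p ξ) {w : Fin n → ℝ} {δ t : ℝ}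
    (hδ : 0 ≤ δ) (j : Fin n) (h0 : 0 ≤ w j) (h1 : w j ≤ t * lam j + δ) :
    redCost r A p j * (w j - t * ξ j) ≤ |redCost r A p j| * δ := by
  rcases lt_trichotomy (redCost r A p j) 0 with hj | hj | hj
  · rw [h.eq_of_neg j hj]
    have : 0 ≤ |redCost r A p j| * δ := by positivity
    nlinarith
  · simp [hj]
  · rw [h.eq_of_pos j hj, abs_of_pos hj]
    gcongr
    linarith

/-- A sum of terms that are not much larger than zero has only small terms if it is not much
smaller than zero. -/
theorem abs_le_of_sum_ge {ι : Type*} [Fintype ι] {f c : ι → ℝ} {a : ℝ} (hc : ∀ j, 0 ≤ c j)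
    (ha : 0 ≤ a) (h : ∀ j, f j ≤ c j) (hs : -a ≤ ∑ j, f j) (j : ι) : |f j| ≤ a + ∑ j, c j := by
  classical
  have h2 : c j ≤ ∑ j, c j := Finset.single_le_sum (fun i _ => hc i) (Finset.mem_univ j)
  rw [abs_le]
  constructor
  · have h1 : ∑ k, (c k - f k) ≤ a + ∑ k, c k := by
      rw [Finset.sum_sub_distrib]; linarith
    have h3 : c j - f j ≤ ∑ k, (c k - f k) := Finset.single_le_sum
      (f := fun k => c k - f k) (fun i _ => sub_nonneg.2 (h i)) (Finset.mem_univ j)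
    linarith [hc j]
  · linarith [h j]

/-- The optimal solution of a perturbed hindsight program is close to the fluid solution. -/
theorem FluidPair.exists_hindsight_bound (h : FluidPair r A lam b p ξ) (hr : ∀ j, 0 ≤ r j)
    (hA : ∀ i j, 0 ≤ A i j) (hgp : GeneralPosition r A) :
    ∃ K : ℝ, 0 < K ∧ ∀ (L δ : ℝ) (v z : Fin n → ℝ), 0 ≤ L → 0 ≤ δ → (∀ j, 0 ≤ v j) →
      (∀ j, |v j - L * lam j| ≤ δ) → IsLPOptimal r A (fun i => L * b i) v z →
      ∀ j, |z j - L * ξ j| ≤ K * δ := by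
  obtain ⟨K, hK, hbd⟩ := hgp.exists_bound p
  set c : ℝ := ∑ j, r j + (∑ j, |redCost r A p j| + ∑ i : Fin m, (0 : ℝ)) with hcdef
  have hc : 0 ≤ c := add_nonneg (Finset.sum_nonneg fun j _ => hr j) (by simp; positivity)
  refine ⟨K * (c + 1), by positivity, fun L δ v z hL hδ hv0 hv hz j => ?_⟩
  have hv1 : ∀ j, L * lam j - δ ≤ v j ∧ v j ≤ L * lam j + δ := fun j => by
    have := abs_le.1 (hv j); constructor <;> linarith
  have hopt : ∑ j, r j * (L * ξ j) - (∑ j, r j) * δ ≤ ∑ j, r j * z j := by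
    -- The scaled fluid solution, truncated at the actual arrivals, is feasible and loses at most
    -- `δ` per type.
    have hmem : (fun j => min (L * ξ j) (v j)) ∈ lpFeasible A (fun i => L * b i) v := by
      refine ⟨fun i => ?_, fun j => ⟨le_min (mul_nonneg hL (h.nonneg j)) (hv0 j),
        min_le_right _ _⟩⟩
      calc ∑ j, A i j * min (L * ξ j) (v j) ≤ ∑ j, A i j * (L * ξ j) :=
            Finset.sum_le_sum fun j _ => mul_le_mul_of_nonneg_left (min_le_left _ _) (hA i j)
        _ = L * ∑ j, A i j * ξ j := by
            rw [Finset.mul_sum]; exact Finset.sum_congr rfl fun j _ => by ring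
        _ ≤ L * b i := mul_le_mul_of_nonneg_left (h.feasible i) hL
    refine le_trans ?_ (hz.2 hmem)
    rw [Finset.sum_mul, ← Finset.sum_sub_distrib]
    refine Finset.sum_le_sum fun j _ => ?_
    rw [← mul_sub]
    refine mul_le_mul_of_nonneg_left (le_min (by linarith) ?_) (hr j)
    have := mul_le_mul_of_nonneg_left (h.le j) hL
    linarith [hv1 j]
  obtain ⟨⟨hzf, hzv⟩, -⟩ := hz
  have hprice : ∀ i, p i * ∑ j, A i j * (z j - L * ξ j) ≤ 0 := fun i => by
    have h1 : p i * ∑ j, A i j * (z j - L * ξ j)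
        = p i * (∑ j, A i j * z j - L * b i) + L * (p i * (b i - ∑ j, A i j * ξ j)) := by
      have : ∑ j, A i j * (z j - L * ξ j) = ∑ j, A i j * z j - L * ∑ j, A i j * ξ j := by
        rw [Finset.mul_sum, ← Finset.sum_sub_distrib]
        exact Finset.sum_congr rfl fun j _ => by ring
      rw [this]; ring
    rw [h1, h.slack, mul_zero, add_zero]
    exact mul_nonpos_of_nonneg_of_nonpos (h.price_nonneg i) (by linarith [hzf i])
  -- The revenue difference from `L ξ` splits into reduced-revenue and price terms. None is much
  -- above zero and the sum is not much below zero, so each is `O(δ)`, which is the input of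
  -- `exists_bound`.
  have hterm : ∀ l : Fin n ⊕ Fin m,
      |Sum.elim (fun j => redCost r A p j * (z j - L * ξ j))
        (fun i => p i * ∑ j, A i j * (z j - L * ξ j)) l| ≤ (∑ j, r j) * δ +
        ∑ l, Sum.elim (fun j => |redCost r A p j| * δ) (fun _ : Fin m => 0 * δ) l := by
    refine abs_le_of_sum_ge ?_ (mul_nonneg (Finset.sum_nonneg fun j _ => hr j) hδ) ?_ ?_
    · rintro (j | i)
      · exact mul_nonneg (abs_nonneg _) hδ
      · simp
    · rintro (j | i)
      · exact h.redCost_mul_le hδ j (hzv j).1 ((hzv j).2.trans (hv1 j).2)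
      · simpa using hprice i
    · rw [Fintype.sum_sum_type]
      simp only [Sum.elim_inl, Sum.elim_inr]
      rw [← sum_redCost_mul]
      simp only [mul_sub, Finset.sum_sub_distrib]
      linarith
  have hceq : (∑ j, r j) * δ +
      ∑ l, Sum.elim (fun j => |redCost r A p j| * δ) (fun _ : Fin m => 0 * δ) l = c * δ := by
    rw [Fintype.sum_sum_type]
    simp only [Sum.elim_inl, Sum.elim_inr, ← Finset.sum_mul, hcdef]
    ring
  rw [hceq] at hterm
  refine (hbd (fun j => z j - L * ξ j) (c * δ) (by positivity) (fun j => hterm (Sum.inl j))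
    (fun i => hterm (Sum.inr i)) j).trans ?_
  nlinarith [mul_nonneg hK.le hδ]

end NRM

namespace NRM

/-! ### Projected gradient descent on an interval -/

/-- Projection onto an interval does not increase the distance to its points. -/
theorem sq_clip_sub_le {x q M : ℝ} (h0 : 0 ≤ q) (h1 : q ≤ M) :
    (min (max 0 x) M - q) ^ 2 ≤ (x - q) ^ 2 := by
  rw [sq_le_sq, abs_le]
  rcases le_total 0 x with hx | hx
  · rw [max_eq_right hx]
    rcases le_total x M with hM | hM
    · rw [min_eq_left hM]
      exact ⟨neg_abs_le _, le_abs_self _⟩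
    · rw [min_eq_right hM, abs_of_nonneg (by linarith)]
      constructor <;> linarith
  · rw [max_eq_left hx, min_eq_left (by linarith), abs_of_nonpos (by linarith)]
    constructor <;> linarith

theorem inv_two_sqrt_le (N : ℕ) :
    1 / (2 * √((N + 1 : ℕ) : ℝ)) ≤ √((N + 1 : ℕ) : ℝ) - √(N : ℝ) := by
  have h1 : 0 < √((N + 1 : ℕ) : ℝ) := Real.sqrt_pos.2 (by positivity)
  have h2 : √((N + 1 : ℕ) : ℝ) ^ 2 = N + 1 := by rw [Real.sq_sqrt (by positivity)]; push_cast; ring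
  have h3 : √(N : ℝ) ^ 2 = N := Real.sq_sqrt (by positivity)
  rw [div_le_iff₀ (by positivity)]
  nlinarith [sq_nonneg (√((N + 1 : ℕ) : ℝ) - √(N : ℝ))]

/-- Regret bound for projected gradient descent with step sizes `η / √u` on `[0, M]`. -/
theorem sum_mul_sub_le_of_gradient_step {θ g : ℕ → ℝ} {M η G q : ℝ} (hη : 0 < η)
    (hθ : ∀ u, 0 ≤ θ u ∧ θ u ≤ M) (hg : ∀ u, |g u| ≤ G)
    (hstep : ∀ u, θ (u + 1) = min (max 0 (θ u - η / √((u + 1 : ℕ) : ℝ) * g u)) M)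
    (h0 : 0 ≤ q) (h1 : q ≤ M) (N : ℕ) :
    ∑ u ∈ Finset.range N, g u * (θ u - q) ≤ (M ^ 2 / (2 * η) + η * G ^ 2) * √(N : ℝ) := by
  -- The weighted squared distance to the comparator serves as potential: the growth of its weight
  -- costs at most `M ^ 2` times the increment of `√N`, and `inv_two_sqrt_le` makes the squared
  -- gradient terms telescope in the same way.
  suffices h : ∑ u ∈ Finset.range N, g u * (θ u - q) + √(N : ℝ) / (2 * η) * (θ N - q) ^ 2
      ≤ (M ^ 2 / (2 * η) + η * G ^ 2) * √(N : ℝ) by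
    have : 0 ≤ √(N : ℝ) / (2 * η) * (θ N - q) ^ 2 := by positivity
    linarith
  induction N with
  | zero => simp
  | succ N ih =>
    rw [Finset.sum_range_succ]
    set R := √((N + 1 : ℕ) : ℝ) with hR
    set S := √(N : ℝ) with hS
    have hRpos : 0 < R := Real.sqrt_pos.2 (by positivity)
    have hRS : 0 < 1 / (2 * R) := by positivity
    have hinv : 1 / (2 * R) ≤ R - S := inv_two_sqrt_le N
    have hclip := sq_clip_sub_le (x := θ N - η / R * g N) h0 h1
    rw [← hstep N] at hclip
    have hsq : (θ N - q) ^ 2 ≤ M ^ 2 := by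
      rw [sq_le_sq, abs_of_nonneg (h0.trans h1), abs_le]
      constructor <;> linarith [hθ N]
    have hg2 : (g N) ^ 2 ≤ G ^ 2 := by
      rw [← sq_abs]; exact pow_le_pow_left₀ (abs_nonneg _) (hg N) 2
    have e1 : R / (2 * η) * (θ (N + 1) - q) ^ 2
        ≤ R / (2 * η) * (θ N - q) ^ 2 - g N * (θ N - q) + η * (1 / (2 * R)) * (g N) ^ 2 := by
      calc R / (2 * η) * (θ (N + 1) - q) ^ 2
          ≤ R / (2 * η) * (θ N - η / R * g N - q) ^ 2 := by gcongr
        _ = _ := by field_simp; ring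
    have e2 : η * (1 / (2 * R)) * (g N) ^ 2 ≤ η * (R - S) * G ^ 2 := by
      have : 0 ≤ R - S := by linarith
      gcongr
    have e3 : (R - S) / (2 * η) * (θ N - q) ^ 2 ≤ (R - S) / (2 * η) * M ^ 2 := by
      have : 0 ≤ R - S := by linarith
      gcongr
    have e4 : R / (2 * η) * (θ N - q) ^ 2
        = S / (2 * η) * (θ N - q) ^ 2 + (R - S) / (2 * η) * (θ N - q) ^ 2 := by ring
    have e5 : (M ^ 2 / (2 * η) + η * G ^ 2) * R = (M ^ 2 / (2 * η) + η * G ^ 2) * S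
        + ((R - S) / (2 * η) * M ^ 2 + η * (R - S) * G ^ 2) := by ring
    linarith

/-! ### Scaling of the constants of `FF` -/

variable {m n : ℕ} {r : Fin n → ℝ} {A : Matrix (Fin m) (Fin n) ℝ} {b : Fin m → ℝ}

/-- Scale invariance of the constants of `FF` is what allows bounds uniform in the system and in the
phase. -/
theorem thetaBar_smul {L : ℝ} (hL : 0 < L) :
    thetaBar r A (fun i => L * b i) = thetaBar r A b := by
  rw [thetaBar, thetaBar, ← Real.mul_iSup_of_nonneg hL.le, ← Real.mul_iInf_of_nonneg hL.le,
    mul_div_mul_left _ _ hL.ne']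

theorem diamBound_smul {L : ℝ} (hL : 0 < L) :
    diamBound r A (fun i => L * b i) = diamBound r A b := by
  rw [diamBound, diamBound, thetaBar_smul hL]

theorem gradBound_smul {L : ℝ} (hL : 0 < L) :
    gradBound A (fun i => L * b i) L = gradBound A b 1 := by
  rw [gradBound, gradBound, ← Real.mul_iSup_of_nonneg hL.le, mul_div_cancel_left₀ _ hL.ne',
    div_one]

theorem iInf_pos [NeZero m] (hb : ∀ i, 0 < b i) : 0 < ⨅ i, b i := by
  obtain ⟨i, hi⟩ := exists_eq_ciInf_of_finite (f := b)
  rw [← hi]; exact hb i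

theorem le_iSup_fin (b : Fin m → ℝ) (i : Fin m) : b i ≤ ⨆ i, b i :=
  le_ciSup (Set.finite_range b).bddAbove i

theorem one_le_iSup_div_iInf [NeZero m] (hb : ∀ i, 0 < b i) : 1 ≤ (⨆ i, b i) / ⨅ i, b i := by
  rw [le_div_iff₀ (iInf_pos hb), one_mul]
  exact (ciInf_le (Set.finite_range b).bddBelow 0).trans (le_iSup_fin b 0)

theorem sum_alphaBar_le_thetaBar [NeZero m] (hr : ∀ j, 0 ≤ r j) (hA : ∀ i j, 0 ≤ A i j)
    (hb : ∀ i, 0 < b i) : ∑ i, alphaBar r A i ≤ thetaBar r A b :=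
  le_mul_of_one_le_left (Finset.sum_nonneg fun i _ => alphaBar_nonneg hr hA i)
    (one_le_iSup_div_iInf hb)

theorem alphaBar_le_thetaBar [NeZero m] (hr : ∀ j, 0 ≤ r j) (hA : ∀ i j, 0 ≤ A i j)
    (hb : ∀ i, 0 < b i) (i : Fin m) : alphaBar r A i ≤ thetaBar r A b :=
  (Finset.single_le_sum (fun i _ => alphaBar_nonneg hr hA i) (Finset.mem_univ i)).trans
    (sum_alphaBar_le_thetaBar hr hA hb)

theorem gradBound_pos [NeZero m] (hA : ∀ i j, 0 ≤ A i j) (hb : ∀ i, 0 < b i) :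
    0 < gradBound A b 1 := by
  have h1 : 0 < √(m : ℝ) := Real.sqrt_pos.2 (by exact_mod_cast NeZero.pos m)
  have h2 : 0 ≤ aBar A := Real.iSup_nonneg fun i => Real.iSup_nonneg fun j => hA i j
  have h3 : 0 < ⨆ i, b i := (hb 0).trans_le (le_iSup_fin b 0)
  rw [gradBound, div_one]
  positivity

/-! ### The trajectory of `FF` -/

section Trajectory

open Classical in
/-- Indicator that `FF` is still active in the `u`-th period after its start. -/
noncomputable def ffActive (r : Fin n → ℝ) (A : Matrix (Fin m) (Fin n) ℝ)
    (B : Fin m → ℝ) (L : ℝ) (t₁ : ℕ) (X : ℕ → Fin n) (u : ℕ) : ℝ :=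
  if Sufficient A (ffState r A B L t₁ X u).cap then 1 else 0

open Classical in
/-- The decision of `FF` in the `u`-th period after its start. -/
noncomputable def ffDecision (r : Fin n → ℝ) (A : Matrix (Fin m) (Fin n) ℝ)
    (B : Fin m → ℝ) (L : ℝ) (t₁ : ℕ) (X : ℕ → Fin n) (u : ℕ) : ℝ :=
  if ffAcceptsIn r A (ffState r A B L t₁ X u) (X (t₁ + u)) then 1 else 0

/-- The number of active periods among the first `N` ones. -/
noncomputable def ffTime (r : Fin n → ℝ) (A : Matrix (Fin m) (Fin n) ℝ)
    (B : Fin m → ℝ) (L : ℝ) (t₁ : ℕ) (X : ℕ → Fin n) (N : ℕ) : ℝ :=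
  ∑ u ∈ Finset.range N, ffActive r A B L t₁ X u

/-- The number of type-`j` customers accepted by `FF` in its first `N` periods. -/
noncomputable def ffCount (r : Fin n → ℝ) (A : Matrix (Fin m) (Fin n) ℝ)
    (B : Fin m → ℝ) (L : ℝ) (t₁ : ℕ) (X : ℕ → Fin n) (N : ℕ) (j : Fin n) : ℝ :=
  ∑ u ∈ Finset.range N, if X (t₁ + u) = j then ffDecision r A B L t₁ X u else 0

variable (r A) (B : Fin m → ℝ) (L : ℝ) (t₁ : ℕ) (X : ℕ → Fin n)

theorem ffActive_nonneg (u : ℕ) : 0 ≤ ffActive r A B L t₁ X u := by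
  unfold ffActive; split_ifs <;> simp

theorem ffActive_le_one (u : ℕ) : ffActive r A B L t₁ X u ≤ 1 := by
  unfold ffActive; split_ifs <;> simp

theorem ffDecision_nonneg (u : ℕ) : 0 ≤ ffDecision r A B L t₁ X u := by
  unfold ffDecision; split_ifs <;> simp

theorem ffDecision_le_active (u : ℕ) : ffDecision r A B L t₁ X u ≤ ffActive r A B L t₁ X u := by
  unfold ffDecision ffActive ffAcceptsIn
  split_ifs with h1 h2 h2
  · simp
  · exact absurd h1.1 h2
  · simp
  · simp

/-- While active, `FF` accepts exactly when the surplus at its current prices is positive, so it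
collects the positive part. -/
theorem ffDecision_mul_eq (u : ℕ) :
    ffDecision r A B L t₁ X u *
        (r (X (t₁ + u)) - ∑ i, (ffState r A B L t₁ X u).price i * A i (X (t₁ + u)))
      = ffActive r A B L t₁ X u *
        max 0 (r (X (t₁ + u)) - ∑ i, (ffState r A B L t₁ X u).price i * A i (X (t₁ + u))) := by
  unfold ffDecision ffActive ffAcceptsIn
  by_cases h1 : Sufficient A (ffState r A B L t₁ X u).cap
  · by_cases h2 : ∑ i, (ffState r A B L t₁ X u).price i * A i (X (t₁ + u)) < r (X (t₁ + u))
    · rw [if_pos ⟨h1, h2⟩, if_pos h1, max_eq_right (by linarith)]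
    · rw [if_neg (fun h => h2 h.2), if_pos h1, max_eq_left (by linarith)]
      simp
  · rw [if_neg (fun h => h1 h.1), if_neg h1]
    simp

theorem ffTime_le (N : ℕ) : ffTime r A B L t₁ X N ≤ N := by
  calc ffTime r A B L t₁ X N ≤ ∑ u ∈ Finset.range N, (1 : ℝ) :=
        Finset.sum_le_sum fun u _ => ffActive_le_one r A B L t₁ X u
    _ = N := by simp

theorem ffCount_nonneg (N : ℕ) (j : Fin n) : 0 ≤ ffCount r A B L t₁ X N j :=
  Finset.sum_nonneg fun u _ => by
    split_ifs
    · exact ffDecision_nonneg r A B L t₁ X u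
    · exact le_rfl

theorem sum_mul_ffCount (c : Fin n → ℝ) (N : ℕ) :
    ∑ j, c j * ffCount r A B L t₁ X N j
      = ∑ u ∈ Finset.range N, ffDecision r A B L t₁ X u * c (X (t₁ + u)) := by
  simp only [ffCount, Finset.mul_sum]
  rw [Finset.sum_comm]
  refine Finset.sum_congr rfl fun u _ => ?_
  simp [mul_comm]

theorem ffState_cap (N : ℕ) (i : Fin m) :
    (ffState r A B L t₁ X N).cap i = B i - ∑ j, A i j * ffCount r A B L t₁ X N j := by
  rw [sum_mul_ffCount]
  induction N with
  | zero => simp [ffState]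
  | succ N ih =>
    rw [Finset.sum_range_succ, ffState, ffStep, ffDecision]
    by_cases h : Sufficient A (ffState r A B L t₁ X N).cap
    · simp only [if_pos h, ih]; ring
    · rw [if_neg h, ih, if_neg fun h' => h h'.1]; ring

theorem ffTime_eq_of_sufficient (N : ℕ) (h : Sufficient A (ffState r A B L t₁ X N).cap) :
    ffTime r A B L t₁ X N = N := by
  induction N with
  | zero => simp [ffTime]
  | succ N ih =>
    have h1 : Sufficient A (ffState r A B L t₁ X N).cap := by
      by_contra hc
      rw [ffState, ffStep, if_neg hc] at h
      exact hc h
    rw [ffTime, Finset.sum_range_succ, ← ffTime, ih h1, ffActive, if_pos h1]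
    push_cast; ring

/-- Either `FF` is active throughout, or some resource is nearly used up. -/
theorem ffTime_eq_or (N : ℕ) : ffTime r A B L t₁ X N = N ∨
    ∃ i j, B i - ∑ k, A i k * ffCount r A B L t₁ X N k < A i j := by
  by_cases h : Sufficient A (ffState r A B L t₁ X N).cap
  · exact Or.inl (ffTime_eq_of_sufficient r A B L t₁ X N h)
  · right
    simp only [Sufficient, not_forall, not_le] at h
    obtain ⟨j, i, h⟩ := h
    exact ⟨i, j, by rwa [← ffState_cap]⟩

variable {r A B}

/-- Customers are accepted only while every type fits, so the virtual capacity never becomes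
negative. -/
theorem sum_mul_ffCount_le (hA : ∀ i j, 0 ≤ A i j) (hB : ∀ i, 0 ≤ B i) (N : ℕ) (i : Fin m) :
    ∑ j, A i j * ffCount r A B L t₁ X N j ≤ B i := by
  rw [← sub_nonneg, ← ffState_cap]
  induction N with
  | zero => exact hB i
  | succ N ih =>
    rw [ffState, ffStep]
    by_cases h : Sufficient A (ffState r A B L t₁ X N).cap
    · simp only [if_pos h]
      have h1 := h (X (t₁ + N)) i
      have h2 := hA i (X (t₁ + N))
      split_ifs <;> linarith
    · rwa [if_neg h]

theorem ffState_price_mem (hM : 0 ≤ thetaBar r A B) (N : ℕ) (i : Fin m) :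
    0 ≤ (ffState r A B L t₁ X N).price i ∧
      (ffState r A B L t₁ X N).price i ≤ thetaBar r A B := by
  induction N with
  | zero => exact ⟨le_rfl, hM⟩
  | succ N ih =>
    rw [ffState, ffStep]
    by_cases h : Sufficient A (ffState r A B L t₁ X N).cap
    · rw [if_pos h]
      exact ⟨le_min (le_max_left _ _) hM, min_le_right _ _⟩
    · rwa [if_neg h]

/-- Multiplying by the activity indicator makes the gradient zero after stopping. The frozen prices
thus still follow the descent recursion, and the regret bound applies without a stopping time. -/
theorem ffState_price_succ (hM : 0 ≤ thetaBar r A B) (u : ℕ) (i : Fin m) :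
    (ffState r A B L t₁ X (u + 1)).price i
      = min (max 0 ((ffState r A B L t₁ X u).price i
          - diamBound r A B / gradBound A B L / √((u + 1 : ℕ) : ℝ)
            * (ffActive r A B L t₁ X u * (B i / L)
              - ffDecision r A B L t₁ X u * A i (X (t₁ + u))))) (thetaBar r A B) := by
  rw [ffState, ffStep, ffActive, ffDecision]
  by_cases h : Sufficient A (ffState r A B L t₁ X u).cap
  · simp only [if_pos h, one_mul, div_div]
  · have h1 := ffState_price_mem L t₁ X hM u i
    rw [if_neg h, if_neg h, if_neg fun h' => h h'.1]
    simp [h1.1, h1.2]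

end Trajectory

end NRM

/-! ### Regret of `FF`, approximate complementary slackness, and the nondegenerate case -/

namespace NRM

variable {m n : ℕ} {r : Fin n → ℝ} {A : Matrix (Fin m) (Fin n) ℝ} {lam : Fin n → ℝ}
  {b p : Fin m → ℝ} {ξ : Fin n → ℝ}

/-- The centred surplus collected by `FF` in its `u`-th period if a customer of type `j` arrives. -/
noncomputable def rewardNoise (r : Fin n → ℝ) (A : Matrix (Fin m) (Fin n) ℝ) (lam : Fin n → ℝ)
    (B : Fin m → ℝ) (L : ℝ) (t₁ u : ℕ) (X : ℕ → Fin n) (j : Fin n) : ℝ :=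
  ffActive r A B L t₁ X u * (max 0 (redCost r A (ffState r A B L t₁ X u).price j)
    - ∑ k, lam k * max 0 (redCost r A (ffState r A B L t₁ X u).price k))

/-- The centred indicator of an arrival of type `k`, as long as `FF` is active. -/
noncomputable def arrivalNoise (r : Fin n → ℝ) (A : Matrix (Fin m) (Fin n) ℝ) (lam : Fin n → ℝ)
    (B : Fin m → ℝ) (L : ℝ) (t₁ : ℕ) (k : Fin n) (u : ℕ) (X : ℕ → Fin n) (j : Fin n) : ℝ :=
  ffActive r A B L t₁ X u * ((if j = k then 1 else 0) - lam k)

/-- The accumulated noise of the first `N` periods of `FF` is at most `δ`. -/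
structure FFQuiet (r : Fin n → ℝ) (A : Matrix (Fin m) (Fin n) ℝ) (lam : Fin n → ℝ)
    (B : Fin m → ℝ) (L : ℝ) (t₁ : ℕ) (X : ℕ → Fin n) (N : ℕ) (δ : ℝ) : Prop where
  reward : -δ ≤ ∑ u ∈ Finset.range N, rewardNoise r A lam B L t₁ u X (X (t₁ + u))
  arrival : ∀ k, ∑ u ∈ Finset.range N, arrivalNoise r A lam B L t₁ k u X (X (t₁ + u)) ≤ δ

/-- Acceptances of a type are at most its arrivals during active periods, and those follow their
mean up to the noise. -/
theorem FFQuiet.ffCount_le {B : Fin m → ℝ} {L δ : ℝ} {t₁ N : ℕ} {X : ℕ → Fin n}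
    (hq : FFQuiet r A lam B L t₁ X N δ) (k : Fin n) :
    ffCount r A B L t₁ X N k ≤ ffTime r A B L t₁ X N * lam k + δ := by
  have h1 := hq.arrival k
  have h2 : ffCount r A B L t₁ X N k - ffTime r A B L t₁ X N * lam k
      ≤ ∑ u ∈ Finset.range N, arrivalNoise r A lam B L t₁ k u X (X (t₁ + u)) := by
    rw [ffCount, ffTime, Finset.sum_mul, ← Finset.sum_sub_distrib]
    refine Finset.sum_le_sum fun u _ => ?_
    have h3 := ffDecision_le_active r A B L t₁ X u
    rw [arrivalNoise]
    split_ifs <;> linarith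
  linarith

/-- Weak duality for the fluid program. -/
theorem FluidPair.value_le (h : FluidPair r A lam b p ξ) {θ : Fin m → ℝ} (hθ : ∀ i, 0 ≤ θ i) :
    ∑ j, r j * ξ j ≤ ∑ k, lam k * max 0 (redCost r A θ k) + ∑ i, θ i * b i := by
  rw [sum_redCost_mul (A := A) θ]
  refine add_le_add (Finset.sum_le_sum fun k _ => ?_) (Finset.sum_le_sum fun i _ => ?_)
  · calc redCost r A θ k * ξ k ≤ max 0 (redCost r A θ k) * ξ k :=
          mul_le_mul_of_nonneg_right (le_max_right _ _) (h.nonneg k)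
      _ ≤ max 0 (redCost r A θ k) * lam k :=
          mul_le_mul_of_nonneg_left (h.le k) (le_max_left _ _)
      _ = _ := mul_comm _ _
  · exact mul_le_mul_of_nonneg_left (h.feasible i) (hθ i)

/-- Regret of `FF` up to its stopping time. -/
theorem FluidPair.exists_regret [NeZero m] (h : FluidPair r A lam b p ξ)
    (hA : ∀ i j, 0 ≤ A i j) (hb : ∀ i, 0 < b i) (hM : 0 < thetaBar r A b) :
    ∃ C : ℝ, 0 < C ∧ ∀ (L δ : ℝ) (t₁ N : ℕ) (X : ℕ → Fin n), 0 < L → √(N : ℝ) ≤ δ →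
      FFQuiet r A lam (fun i => L * b i) L t₁ X N δ →
      ∀ q : Fin m → ℝ, (∀ i, 0 ≤ q i) → (∀ i, q i ≤ thetaBar r A b) →
      ffTime r A (fun i => L * b i) L t₁ X N * ∑ j, r j * ξ j
          - ∑ j, r j * ffCount r A (fun i => L * b i) L t₁ X N j
        ≤ ∑ i, q i * (ffTime r A (fun i => L * b i) L t₁ X N * b i
            - ∑ j, A i j * ffCount r A (fun i => L * b i) L t₁ X N j) + C * δ := by
  have hm : 0 < √(m : ℝ) := Real.sqrt_pos.2 (by exact_mod_cast NeZero.pos m)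
  set η : ℝ := diamBound r A b / gradBound A b 1 with hη
  have hη0 : 0 < η := div_pos (mul_pos hM hm) (gradBound_pos hA hb)
  set M := thetaBar r A b with hMdef
  -- A crude bound on the gradient coordinates; unlike `gradBound` it does not enter the step size,
  -- only the constant.
  set G : ℝ := ∑ i, b i + ∑ i, ∑ j, A i j with hG
  set C₀ : ℝ := M ^ 2 / (2 * η) + η * G ^ 2 with hC₀
  have hC₀pos : 0 ≤ C₀ := by positivity
  refine ⟨m * C₀ + 1, by positivity, fun L δ t₁ N X hL hN hquiet q hq0 hq1 => ?_⟩
  set B : Fin m → ℝ := fun i => L * b i with hB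
  have hMB : thetaBar r A B = M := thetaBar_smul hL
  let θ : ℕ → Fin m → ℝ := fun u => (ffState r A B L t₁ X u).price
  let y : ℕ → ℝ := fun u => ffDecision r A B L t₁ X u
  let e : ℕ → ℝ := fun u => ffActive r A B L t₁ X u
  let g : Fin m → ℕ → ℝ := fun i u => e u * b i - y u * A i (X (t₁ + u))
  have hθ : ∀ i u, 0 ≤ θ u i ∧ θ u i ≤ M := fun i u => by
    have := ffState_price_mem (r := r) (A := A) (B := B) L t₁ X (hMB ▸ hM.le) u i
    rwa [hMB] at this
  have hregret : ∀ i, ∑ u ∈ Finset.range N, g i u * (θ u i - q i) ≤ C₀ * √(N : ℝ) := fun i => by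
    refine sum_mul_sub_le_of_gradient_step hη0 (hθ i) (fun u => ?_) (fun u => ?_) (hq0 i) (hq1 i) N
    · have e1 : b i ≤ ∑ i, b i :=
        Finset.single_le_sum (fun i _ => (hb i).le) (Finset.mem_univ i)
      have e2 : A i (X (t₁ + u)) ≤ ∑ i, ∑ j, A i j :=
        (Finset.single_le_sum (fun j _ => hA i j) (Finset.mem_univ (X (t₁ + u)))).trans
          (Finset.single_le_sum (f := fun i => ∑ j, A i j)
            (fun i _ => Finset.sum_nonneg fun j _ => hA i j) (Finset.mem_univ i))
      have e3 := ffActive_nonneg r A B L t₁ X u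
      have e4 := ffActive_le_one r A B L t₁ X u
      have e5 := ffDecision_nonneg r A B L t₁ X u
      have e6 := (ffDecision_le_active r A B L t₁ X u).trans e4
      have e7 := mul_le_mul_of_nonneg_right e4 (hb i).le
      have e8 := mul_le_mul_of_nonneg_right e6 (hA i (X (t₁ + u)))
      have e9 := mul_nonneg e3 (hb i).le
      have e10 := mul_nonneg e5 (hA i (X (t₁ + u)))
      have e11 := hA i (X (t₁ + u))
      have e12 := (hb i).le
      rw [abs_le]
      constructor <;> simp only [g, e, y, hG] <;> linarith
    · have := ffState_price_succ (r := r) (A := A) (B := B) L t₁ X (hMB ▸ hM.le) u i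
      rw [hMB, hB, diamBound_smul hL, gradBound_smul hL, mul_div_cancel_left₀ _ hL.ne'] at this
      exact this
  have hs : ∀ i, ∑ u ∈ Finset.range N, g i u
      = ffTime r A B L t₁ X N * b i - ∑ j, A i j * ffCount r A B L t₁ X N j := fun i => by
    rw [sum_mul_ffCount, ffTime, Finset.sum_mul, ← Finset.sum_sub_distrib]
  have hsumreg : ∑ u ∈ Finset.range N, ∑ i, g i u * θ u i ≤
      ∑ i, q i * (ffTime r A B L t₁ X N * b i - ∑ j, A i j * ffCount r A B L t₁ X N j)
        + m * C₀ * √(N : ℝ) := by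
    rw [Finset.sum_comm]
    have : (m * C₀ * √(N : ℝ) : ℝ) = ∑ _i : Fin m, C₀ * √(N : ℝ) := by simp; ring
    rw [this, ← Finset.sum_add_distrib]
    refine Finset.sum_le_sum fun i _ => ?_
    have h1 := hregret i
    simp only [mul_sub, Finset.sum_sub_distrib, ← Finset.sum_mul, hs] at h1
    linarith
  -- Weak duality at the current prices: expected surplus plus priced capacity is at least the fluid
  -- value.
  have hperiod : ∀ u, rewardNoise r A lam B L t₁ u X (X (t₁ + u)) + e u * ∑ j, r j * ξ j
      - ∑ i, g i u * θ u i ≤ y u * r (X (t₁ + u)) := fun u => by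
    have h1 := ffDecision_mul_eq r A B L t₁ X u
    have h2 := h.value_le (θ := θ u) fun i => (hθ i u).1
    have h3 := mul_le_mul_of_nonneg_left h2 (ffActive_nonneg r A B L t₁ X u)
    have h4 : ∑ i, g i u * θ u i
        = e u * ∑ i, θ u i * b i - y u * ∑ i, θ u i * A i (X (t₁ + u)) := by
      rw [Finset.mul_sum, Finset.mul_sum, ← Finset.sum_sub_distrib]
      exact Finset.sum_congr rfl fun i _ => by simp only [g]; ring
    rw [h4, rewardNoise]
    simp only [redCost, θ, y, e] at h1 h3 ⊢
    linarith
  have htotal := Finset.sum_le_sum fun u (_ : u ∈ Finset.range N) => hperiod u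
  rw [Finset.sum_sub_distrib, Finset.sum_add_distrib, ← Finset.sum_mul] at htotal
  have h5 : ∑ u ∈ Finset.range N, y u * r (X (t₁ + u))
      = ∑ j, r j * ffCount r A B L t₁ X N j := (sum_mul_ffCount r A B L t₁ X r N).symm
  have h6 : ∑ u ∈ Finset.range N, e u = ffTime r A B L t₁ X N := rfl
  have h7 := hquiet.reward
  have h8 : m * C₀ * √(N : ℝ) ≤ m * C₀ * δ := by gcongr
  rw [h5, h6] at htotal
  linarith

/-- Consequences of the regret bound: `FF` nearly satisfies complementary slackness. -/
theorem FluidPair.exists_ff_slackness [NeZero m] (h : FluidPair r A lam b p ξ)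
    (hr : ∀ j, 0 ≤ r j) (hA : ∀ i j, 0 ≤ A i j) (hb : ∀ i, 0 < b i)
    (hM : 0 < thetaBar r A b) :
    ∃ C : ℝ, 0 < C ∧ ∀ (L δ : ℝ) (t₁ N : ℕ) (X : ℕ → Fin n), 0 < L → √(N : ℝ) ≤ δ →
      FFQuiet r A lam (fun i => L * b i) L t₁ X N δ →
      (∀ j, |redCost r A p j * (ffCount r A (fun i => L * b i) L t₁ X N j
        - ffTime r A (fun i => L * b i) L t₁ X N * ξ j)| ≤ C * δ) ∧
      (∀ i, p i * (ffTime r A (fun i => L * b i) L t₁ X N * b i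
            - ∑ j, A i j * ffCount r A (fun i => L * b i) L t₁ X N j) ≤ C * δ) ∧
      (∀ i, (thetaBar r A b - p i) * (∑ j, A i j * ffCount r A (fun i => L * b i) L t₁ X N j
            - ffTime r A (fun i => L * b i) L t₁ X N * b i) ≤ C * δ) := by
  obtain ⟨C, hC, hreg⟩ := h.exists_regret hA hb hM
  refine ⟨C + ∑ j, |redCost r A p j|, by positivity, fun L δ t₁ N X hL hN hquiet => ?_⟩
  have hδ : 0 ≤ δ := (Real.sqrt_nonneg _).trans hN
  have hpM : ∀ i, p i ≤ thetaBar r A b := fun i =>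
    (h.price_le i).trans (alphaBar_le_thetaBar hr hA hb i)
  have hreg := hreg L δ t₁ N X hL hN hquiet
  set x := ffCount r A (fun i => L * b i) L t₁ X N with hx
  set τ := ffTime r A (fun i => L * b i) L t₁ X N with hτ
  have hterm : ∀ j, redCost r A p j * (x j - τ * ξ j) ≤ |redCost r A p j| * δ := fun j =>
    h.redCost_mul_le hδ j (ffCount_nonneg r A _ L t₁ X N j) (hquiet.ffCount_le j)
  have hid : ∑ j, r j * x j - τ * ∑ j, r j * ξ j
      = ∑ j, redCost r A p j * (x j - τ * ξ j) - ∑ i, p i * (τ * b i - ∑ j, A i j * x j) := by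
    have h1 : ∑ i, p i * b i = ∑ i, p i * ∑ j, A i j * ξ j :=
      Finset.sum_congr rfl fun i _ => by linarith [h.slack i]
    rw [sum_redCost_mul (A := A) p x, sum_redCost_mul (A := A) p ξ, ← h1]
    simp only [mul_sub, Finset.sum_sub_distrib, mul_add, Finset.mul_sum, mul_left_comm _ τ]
    ring
  have hmain : ∀ q : Fin m → ℝ, (∀ i, 0 ≤ q i) → (∀ i, q i ≤ thetaBar r A b) →
      ∑ i, (p i - q i) * (τ * b i - ∑ j, A i j * x j) - C * δ
        ≤ ∑ j, redCost r A p j * (x j - τ * ξ j) := fun q hq0 hq1 => by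
    have h1 := hreg q hq0 hq1
    simp only [sub_mul, Finset.sum_sub_distrib]
    linarith
  have hupper : ∑ j, redCost r A p j * (x j - τ * ξ j) ≤ (∑ j, |redCost r A p j|) * δ := by
    rw [Finset.sum_mul]; exact Finset.sum_le_sum fun j _ => hterm j
  have hone : ∀ i t, 0 ≤ t → t ≤ thetaBar r A b →
      (p i - t) * (τ * b i - ∑ j, A i j * x j) ≤ (C + ∑ j, |redCost r A p j|) * δ := by
    intro i t ht0 ht1
    -- The comparator is `p` with one coordinate changed. Then `t = 0` bounds unused priced
    -- capacity, while `t = θ̄` bounds overuse at the rate `θ̄ - p i`.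
    have h1 := hmain (Function.update p i t) (fun k => ?_) (fun k => ?_)
    · rw [Finset.sum_eq_single i (fun k _ hk => by simp [hk]) (by simp),
        Function.update_self] at h1
      linarith
    all_goals
      by_cases hk : k = i
      · subst hk; simpa
      · simpa [hk] using by first | exact h.price_nonneg k | exact hpM k
  refine ⟨fun j => ?_, fun i => ?_, fun i => ?_⟩
  · have h1 := hmain p h.price_nonneg hpM
    simp only [sub_self, zero_mul, Finset.sum_const_zero, zero_sub] at h1
    refine (abs_le_of_sum_ge (fun j => mul_nonneg (abs_nonneg _) hδ) (by positivity)
      hterm h1 j).trans ?_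
    rw [← Finset.sum_mul, ← add_mul]
  · simpa using hone i 0 le_rfl hM.le
  · have := hone i (thetaBar r A b) hM.le le_rfl
    linarith

/-- If all optimal prices are below the price cap, the numbers of customers accepted by `FF`
follow the fluid solution. -/
theorem FluidPair.exists_ff_bound [NeZero m] (h : FluidPair r A lam b p ξ)
    (hr : ∀ j, 0 ≤ r j) (hA : ∀ i j, 0 ≤ A i j) (hb : ∀ i, 0 < b i)
    (hgp : GeneralPosition r A) (hM : 0 < thetaBar r A b) (hp : ∀ i, p i < thetaBar r A b) :
    ∃ K : ℝ, 0 < K ∧ ∀ (L δ : ℝ) (t₁ N : ℕ) (X : ℕ → Fin n), 0 < L → N ≤ L → √(N : ℝ) ≤ δ →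
      1 ≤ δ → FFQuiet r A lam (fun i => L * b i) L t₁ X N δ →
      ∀ j, |ffCount r A (fun i => L * b i) L t₁ X N j - N * ξ j| ≤ K * δ := by
  obtain ⟨C, hC, hsl⟩ := h.exists_ff_slackness hr hA hb hM
  obtain ⟨K₁, hK₁, hbd⟩ := hgp.exists_bound p
  have hM' : ∀ i, 0 < thetaBar r A b - p i := fun i => sub_pos.2 (hp i)
  have hpc : ∀ i, 0 ≤ p i * (C / (thetaBar r A b - p i)) := fun i =>
    mul_nonneg (h.price_nonneg i) (div_nonneg hC.le (hM' i).le)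
  set D : ℝ := C + ∑ i, p i * (C / (thetaBar r A b - p i)) with hD
  have hD0 : 0 ≤ D := add_nonneg hC.le (Finset.sum_nonneg fun i _ => hpc i)
  set E : ℝ := ∑ i, (C / (thetaBar r A b - p i) + ∑ j, A i j) / b i with hE
  have hEi : ∀ i, 0 ≤ (C / (thetaBar r A b - p i) + ∑ j, A i j) / b i := fun i =>
    div_nonneg (add_nonneg (div_nonneg hC.le (hM' i).le) (Finset.sum_nonneg fun j _ => hA i j))
      (hb i).le
  have hE0 : 0 ≤ E := Finset.sum_nonneg fun i _ => hEi i
  have hξ0 : 0 ≤ ∑ j, ξ j := Finset.sum_nonneg fun j _ => h.nonneg j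
  refine ⟨K₁ * D + E * ∑ j, ξ j + 1, by positivity,
    fun L δ t₁ N X hL hNL hN hδ hquiet j => ?_⟩
  have hδ0 : 0 ≤ δ := by linarith
  obtain ⟨h1, h2, h3⟩ := hsl L δ t₁ N X hL hN hquiet
  have hexhaust := ffTime_eq_or r A (fun i => L * b i) L t₁ X N
  have hτN := ffTime_le r A (fun i => L * b i) L t₁ X N
  set x := ffCount r A (fun i => L * b i) L t₁ X N with hx
  set τ := ffTime r A (fun i => L * b i) L t₁ X N with hτ
  have h4 : ∀ i, ∑ j, A i j * x j - τ * b i ≤ C / (thetaBar r A b - p i) * δ := fun i => by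
    rw [div_mul_eq_mul_div, le_div_iff₀ (hM' i), mul_comm]
    exact h3 i
  have h5 : |x j - τ * ξ j| ≤ K₁ * (D * δ) := by
    refine hbd (fun j => x j - τ * ξ j) (D * δ) (by positivity) (fun j => (h1 j).trans ?_)
      (fun i => ?_) j
    · gcongr
      exact le_add_of_nonneg_right (Finset.sum_nonneg fun i _ => hpc i)
    · have e1 : p i * ∑ j, A i j * (x j - τ * ξ j) = p i * (∑ j, A i j * x j - τ * b i) := by
        have : ∑ j, A i j * (x j - τ * ξ j) = ∑ j, A i j * x j - τ * ∑ j, A i j * ξ j := by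
          rw [Finset.mul_sum, ← Finset.sum_sub_distrib]
          exact Finset.sum_congr rfl fun j _ => by ring
        rw [this]
        linear_combination τ * h.slack i
      have e2 : p i * (C / (thetaBar r A b - p i)) ≤ D := by
        have : p i * (C / (thetaBar r A b - p i)) ≤ ∑ i, p i * (C / (thetaBar r A b - p i)) :=
          Finset.single_le_sum (fun i _ => hpc i) (Finset.mem_univ i)
        linarith
      have e3 : C ≤ D := le_add_of_nonneg_right (Finset.sum_nonneg fun i _ => hpc i)
      rw [e1, abs_le]
      constructor
      · have := h2 i
        have := mul_le_mul_of_nonneg_right e3 hδ0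
        linarith
      · have := mul_le_mul_of_nonneg_left (h4 i) (h.price_nonneg i)
        have := mul_le_mul_of_nonneg_right e2 hδ0
        linarith
  -- If `FF` stops early, some resource is used up to a bounded remainder; since overuse relative to
  -- the active time is `O(δ)`, the active time is at least `L - O(δ)`, and `N ≤ L`.
  have h6 : N - τ ≤ E * δ := by
    rcases hexhaust with hs | ⟨i, k, hs⟩
    · rw [hs, sub_self]; positivity
    · have e1 : A i k ≤ ∑ j, A i j :=
        Finset.single_le_sum (fun j _ => hA i j) (Finset.mem_univ k)
      have e2 : (L - τ) * b i ≤ (C / (thetaBar r A b - p i) + ∑ j, A i j) * δ := by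
        have := mul_le_mul_of_nonneg_left hδ ((hA i k).trans e1)
        linarith [h4 i]
      have e3 : (C / (thetaBar r A b - p i) + ∑ j, A i j) / b i ≤ E :=
        Finset.single_le_sum (f := fun i => (C / (thetaBar r A b - p i) + ∑ j, A i j) / b i)
          (fun i _ => hEi i) (Finset.mem_univ i)
      have e4 : L - τ ≤ (C / (thetaBar r A b - p i) + ∑ j, A i j) / b i * δ := by
        rw [div_mul_eq_mul_div, le_div_iff₀ (hb i)]; exact e2
      have := mul_le_mul_of_nonneg_right e3 hδ0
      linarith
  have h7 : ξ j ≤ ∑ j, ξ j := Finset.single_le_sum (fun j _ => h.nonneg j) (Finset.mem_univ j)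
  have h8 : |(N - τ) * ξ j| ≤ E * δ * ∑ j, ξ j := by
    rw [abs_of_nonneg (mul_nonneg (by linarith) (h.nonneg j))]
    exact mul_le_mul h6 h7 (h.nonneg j) (by positivity)
  calc |x j - N * ξ j| = |(x j - τ * ξ j) - (N - τ) * ξ j| := by ring_nf
    _ ≤ |x j - τ * ξ j| + |(N - τ) * ξ j| := abs_sub _ _
    _ ≤ (K₁ * D + E * ∑ j, ξ j + 1) * δ := by linarith

end NRM

/-! ### The degenerate case: an optimal price at the cap -/

namespace NRM

variable {m n : ℕ} {r : Fin n → ℝ} {A : Matrix (Fin m) (Fin n) ℝ} {lam : Fin n → ℝ}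
  {b p : Fin m → ℝ} {ξ : Fin n → ℝ}

/-- The degenerate fluid programs, in which an optimal price equals the price cap: only the
resource `i₀` is used at all, and only the type `j₀` is served. -/
structure SingleType (r : Fin n → ℝ) (A : Matrix (Fin m) (Fin n) ℝ) (b p : Fin m → ℝ)
    (ξ : Fin n → ℝ) (i₀ : Fin m) (j₀ : Fin n) : Prop where
  unused : ∀ k, k ≠ i₀ → ∀ j, A k j = 0
  use_pos : 0 < A i₀ j₀
  price_pos : 0 < p i₀
  binding : A i₀ j₀ * ξ j₀ = b i₀
  redCost_eq : redCost r A p j₀ = 0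
  other : ∀ j, j ≠ j₀ → ξ j = 0 ∧ redCost r A p j < 0

/-- The cap is at least the sum of all `alphaBar`, while `p i₀` is at most one of them. Equality
forces all others to vanish, so only `i₀` is used, and at the price `alphaBar r A i₀` no type has
positive reduced revenue. -/
theorem FluidPair.exists_singleType [NeZero m] (h : FluidPair r A lam b p ξ)
    (hr : ∀ j, 0 < r j) (hA : ∀ i j, 0 ≤ A i j) (hA' : ∀ j, ∃ i, A i j ≠ 0)
    (hb : ∀ i, 0 < b i) (hgp : GeneralPosition r A) (hM : 0 < thetaBar r A b)
    {i₀ : Fin m} (hi₀ : thetaBar r A b ≤ p i₀) : ∃ j₀, SingleType r A b p ξ i₀ j₀ := by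
  have hr0 : ∀ j, 0 ≤ r j := fun j => (hr j).le
  have hα := alphaBar_nonneg hr0 hA
  have hsum := sum_alphaBar_le_thetaBar hr0 hA hb
  have hple := h.price_le i₀
  rw [← Finset.add_sum_erase _ _ (Finset.mem_univ i₀)] at hsum
  have hα0 : ∀ k, k ≠ i₀ → alphaBar r A k = 0 := fun k hk => by
    have := Finset.single_le_sum (f := alphaBar r A) (fun i _ => hα i)
      (Finset.mem_erase.2 ⟨hk, Finset.mem_univ k⟩)
    linarith [hα k]
  have hunused : ∀ k, k ≠ i₀ → ∀ j, A k j = 0 := fun k hk j => by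
    by_contra hc
    exact (alphaBar_pos hr hA hc).ne' (hα0 k hk)
  have hp0 : ∀ k, k ≠ i₀ → p k = 0 := fun k hk =>
    le_antisymm ((h.price_le k).trans (hα0 k hk).le) (h.price_nonneg k)
  have hpi : p i₀ = alphaBar r A i₀ := by
    have : 0 ≤ ∑ x ∈ Finset.univ.erase i₀, alphaBar r A x := Finset.sum_nonneg fun i _ => hα i
    linarith
  have hppos : 0 < p i₀ := hM.trans_le hi₀
  have hred : ∀ j, redCost r A p j ≤ 0 := fun j => by
    obtain ⟨i, hi⟩ := hA' j
    have : i = i₀ := by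
      by_contra hc; exact hi (hunused i hc j)
    subst this
    rw [redCost, Finset.sum_eq_single i (fun k _ hk => by rw [hp0 k hk, zero_mul]) (by simp), hpi]
    linarith [le_alphaBar_mul (r := r) hA hi]
  have huniq : ∀ j j', redCost r A p j = 0 → redCost r A p j' = 0 → j = j' := by
    intro j j' hj hj'
    by_contra hne
    -- Two tight types and the `m - 1` zero prices would make `m + 1` tight columns.
    have hsub : insert (Sum.inl j) (insert (Sum.inl j') (Sum.inr '' {k | k ≠ i₀}))
        ⊆ tightSet r A p := by
      rintro l (rfl | rfl | ⟨k, hk, rfl⟩)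
      · exact inl_mem_tightSet.2 hj
      · exact inl_mem_tightSet.2 hj'
      · exact inr_mem_tightSet.2 (hp0 k hk)
    have h1 := (Set.ncard_le_ncard hsub (Set.toFinite _)).trans (hgp.ncard_le p)
    rw [Set.ncard_insert_of_notMem (by simp [hne]) (Set.toFinite _),
      Set.ncard_insert_of_notMem (by simp) (Set.toFinite _),
      Set.ncard_image_of_injective _ Sum.inr_injective] at h1
    have h2 : ({k | k ≠ i₀} : Set (Fin m)).ncard = m - 1 := by
      have := Set.ncard_compl ({i₀} : Set (Fin m))
      rw [Set.ncard_singleton, Nat.card_eq_fintype_card, Fintype.card_fin] at this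
      exact this
    have := NeZero.pos m
    omega
  have hbind : ∑ j, A i₀ j * ξ j = b i₀ := by
    have := (mul_eq_zero.1 (h.slack i₀)).resolve_left hppos.ne'
    linarith
  obtain ⟨j₀, hj₀⟩ : ∃ j, A i₀ j * ξ j ≠ 0 := by
    by_contra! hc
    rw [Finset.sum_eq_zero fun j _ => hc j] at hbind
    exact (hb i₀).ne hbind
  have hj₀r : redCost r A p j₀ = 0 := by
    by_contra hc
    exact hj₀ (by rw [h.eq_of_neg j₀ (lt_of_le_of_ne (hred j₀) hc), mul_zero])
  have hother : ∀ j, j ≠ j₀ → ξ j = 0 ∧ redCost r A p j < 0 := fun j hj => by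
    have : redCost r A p j < 0 :=
      lt_of_le_of_ne (hred j) fun hc => hj (huniq j j₀ hc hj₀r)
    exact ⟨h.eq_of_neg j this, this⟩
  refine ⟨j₀, hunused, lt_of_le_of_ne (hA i₀ j₀) fun hc => hj₀ (by rw [← hc, zero_mul]),
    hppos, ?_, hj₀r, hother⟩
  rw [← hbind, Finset.sum_eq_single j₀ (fun j _ hj => by rw [(hother j hj).1, mul_zero]) (by simp)]

/-- When enough customers of type `j₀` arrive, `L ξ` is feasible and `p` certifies its optimality.
Exact complementary slackness then makes every hindsight optimum exhaust `i₀` with type `j₀` alone.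
-/
theorem SingleType.le_hindsight {i₀ : Fin m} {j₀ : Fin n} (hs : SingleType r A b p ξ i₀ j₀)
    (h : FluidPair r A lam b p ξ) {L : ℝ} {v z : Fin n → ℝ} (hL : 0 ≤ L) (hv : ∀ j, 0 ≤ v j)
    (hz : IsLPOptimal r A (fun i => L * b i) v z) (hle : L * ξ j₀ ≤ v j₀) : L * ξ j₀ ≤ z j₀ := by
  have hmem : (fun j => L * ξ j) ∈ lpFeasible A (fun i => L * b i) v := by
    refine ⟨fun i => ?_, fun j => ⟨mul_nonneg hL (h.nonneg j), ?_⟩⟩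
    · calc ∑ j, A i j * (L * ξ j) = L * ∑ j, A i j * ξ j := by
            rw [Finset.mul_sum]; exact Finset.sum_congr rfl fun j _ => by ring
        _ ≤ L * b i := mul_le_mul_of_nonneg_left (h.feasible i) hL
    · change L * ξ j ≤ v j
      by_cases hj : j = j₀
      · rw [hj]; exact hle
      · rw [(hs.other j hj).1, mul_zero]; exact hv j
  have hopt : ∑ j, r j * (L * ξ j) ≤ ∑ j, r j * z j := hz.2 hmem
  obtain ⟨⟨hz1, hz2⟩, -⟩ := hz
  rw [sum_redCost_mul (A := A) p, sum_redCost_mul (A := A) p z] at hopt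
  have hred : ∀ j, redCost r A p j * z j ≤ 0 := fun j => by
    by_cases hj : j = j₀
    · rw [hj, hs.redCost_eq, zero_mul]
    · exact mul_nonpos_of_nonpos_of_nonneg (hs.other j hj).2.le (hz2 j).1
  have e1 : ∑ j, redCost r A p j * (L * ξ j) = 0 := Finset.sum_eq_zero fun j _ => by
    by_cases hj : j = j₀
    · rw [hj, hs.redCost_eq, zero_mul]
    · rw [(hs.other j hj).1, mul_zero, mul_zero]
  have e2 : ∑ i, p i * ∑ j, A i j * (L * ξ j) = ∑ i, p i * (L * b i) :=
    Finset.sum_congr rfl fun i _ => by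
      have : ∑ j, A i j * (L * ξ j) = L * ∑ j, A i j * ξ j := by
        rw [Finset.mul_sum]; exact Finset.sum_congr rfl fun j _ => by ring
      rw [this]; linear_combination -L * h.slack i
  have e3 : ∀ i, 0 ≤ p i * (L * b i - ∑ j, A i j * z j) := fun i =>
    mul_nonneg (h.price_nonneg i) (sub_nonneg.2 (hz1 i))
  have e4 : ∑ i, p i * (L * b i - ∑ j, A i j * z j) ≤ ∑ j, redCost r A p j * z j := by
    simp only [mul_sub, Finset.sum_sub_distrib] at e1 e2 ⊢
    linarith
  have e5 : ∑ j, redCost r A p j * z j = 0 :=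
    le_antisymm (Finset.sum_nonpos fun j _ => hred j) ((Finset.sum_nonneg fun i _ => e3 i).trans e4)
  have e6 : p i₀ * (L * b i₀ - ∑ j, A i₀ j * z j) ≤ 0 :=
    (Finset.single_le_sum (fun i _ => e3 i) (Finset.mem_univ i₀)).trans (e4.trans e5.le)
  have e7 : L * b i₀ ≤ ∑ j, A i₀ j * z j := by
    by_contra! hc
    exact absurd (mul_pos hs.price_pos (sub_pos.2 hc)) (not_lt.2 e6)
  have e8 : ∀ j, j ≠ j₀ → z j = 0 := fun j hj => by
    have := (Finset.sum_eq_zero_iff_of_nonpos fun j _ => hred j).1 e5 j (Finset.mem_univ j)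
    exact (mul_eq_zero.1 this).resolve_left (hs.other j hj).2.ne
  rw [Finset.sum_eq_single j₀ (fun j _ hj => by rw [e8 j hj, mul_zero]) (by simp), ← hs.binding]
    at e7
  refine le_of_mul_le_mul_left (a := A i₀ j₀) ?_ hs.use_pos
  linarith

/-- Overuse is not penalised when the price is at the cap, so the upper estimate for `j₀` comes from
the virtual capacity. Other types have strictly negative reduced revenue and are accepted only
`O(δ)` times. -/
theorem SingleType.exists_ff_bound [NeZero m] {i₀ : Fin m} {j₀ : Fin n}
    (hs : SingleType r A b p ξ i₀ j₀) (h : FluidPair r A lam b p ξ) (hr : ∀ j, 0 ≤ r j)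
    (hA : ∀ i j, 0 ≤ A i j) (hb : ∀ i, 0 < b i) (hM : 0 < thetaBar r A b) :
    ∃ K : ℝ, 0 < K ∧ ∀ (L δ : ℝ) (t₁ N : ℕ) (X : ℕ → Fin n), 0 < L → N ≤ L → √(N : ℝ) ≤ δ →
      1 ≤ δ → FFQuiet r A lam (fun i => L * b i) L t₁ X N δ →
      ∀ j, N * ξ j - K * δ ≤ ffCount r A (fun i => L * b i) L t₁ X N j ∧
        (ffCount r A (fun i => L * b i) L t₁ X N j ≤ N * ξ j + K * δ ∨
          j = j₀ ∧ ffCount r A (fun i => L * b i) L t₁ X N j ≤ L * ξ j) := by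
  obtain ⟨C, hC, hsl⟩ := h.exists_ff_slackness hr hA hb hM
  set a := A i₀ j₀ with ha
  have ha0 : 0 < a := hs.use_pos
  set R : ℝ := ∑ j, C / |redCost r A p j| with hR
  have hRj : ∀ j, C / |redCost r A p j| ≤ R := fun j => Finset.single_le_sum
    (f := fun j => C / |redCost r A p j|) (fun j _ => div_nonneg hC.le (abs_nonneg _))
    (Finset.mem_univ j)
  set S : ℝ := ∑ j, A i₀ j with hS
  have hS0 : 0 ≤ S := Finset.sum_nonneg fun j _ => hA i₀ j
  have hR0 : 0 ≤ R := Finset.sum_nonneg fun j _ => div_nonneg hC.le (abs_nonneg _)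
  have hCp : 0 ≤ C / p i₀ := div_nonneg hC.le hs.price_pos.le
  refine ⟨R + (C / p i₀ + S + S * R) / a + 1, by positivity,
    fun L δ t₁ N X hL hNL hN hδ hquiet j => ?_⟩
  have hδ0 : 0 ≤ δ := by linarith
  obtain ⟨h1, h2, -⟩ := hsl L δ t₁ N X hL hN hquiet
  have hexhaust := ffTime_eq_or r A (fun i => L * b i) L t₁ X N
  have hx0 := ffCount_nonneg r A (fun i => L * b i) L t₁ X N
  have hcap := sum_mul_ffCount_le (r := r) L t₁ X hA (fun i => (mul_pos hL (hb i)).le) N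
  set x := ffCount r A (fun i => L * b i) L t₁ X N with hx
  set τ := ffTime r A (fun i => L * b i) L t₁ X N with hτ
  have hxj : ∀ j, j ≠ j₀ → x j ≤ R * δ := fun j hj => by
    obtain ⟨e1, e2⟩ := hs.other j hj
    have e3 := h1 j
    rw [e1, mul_zero, sub_zero, abs_mul, abs_of_nonneg (hx0 j)] at e3
    have e4 : x j ≤ C / |redCost r A p j| * δ := by
      rw [div_mul_eq_mul_div, le_div_iff₀ (abs_pos.2 e2.ne)]; linarith
    exact e4.trans (mul_le_mul_of_nonneg_right (hRj j) hδ0)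
  have hK1 : 0 ≤ (C / p i₀ + S + S * R) / a * δ := by positivity
  have hK2 : 0 ≤ R * δ := by positivity
  by_cases hj : j = j₀
  · subst hj
    have hsplit : ∑ k, A i₀ k * x k ≤ a * x j + S * (R * δ) := by
      rw [← Finset.add_sum_erase _ _ (Finset.mem_univ j), hS, Finset.sum_mul]
      gcongr
      refine (Finset.sum_le_sum fun k hk => mul_le_mul_of_nonneg_left
        (hxj k (Finset.ne_of_mem_erase hk)) (hA i₀ k)).trans ?_
      exact Finset.sum_le_sum_of_subset_of_nonneg (Finset.erase_subset _ _)
        fun k _ _ => mul_nonneg (hA i₀ k) hK2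
    -- Either `FF` never stops and the positive price forbids idle capacity, or it stops, which only
    -- the exhaustion of `i₀` can cause.
    have hlow : N * b i₀ - (C / p i₀ + S) * δ ≤ ∑ k, A i₀ k * x k := by
      rcases hexhaust with hst | ⟨i, k, hst⟩
      · have e1 := h2 i₀
        rw [hst] at e1
        have e2 : N * b i₀ - ∑ k, A i₀ k * x k ≤ C / p i₀ * δ := by
          rw [div_mul_eq_mul_div, le_div_iff₀ hs.price_pos]; linarith
        have : 0 ≤ S * δ := by positivity
        linarith
      · have hi : i = i₀ := by
          by_contra hc
          simp only [hs.unused i hc, zero_mul, Finset.sum_const_zero, sub_zero] at hst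
          exact absurd (mul_pos hL (hb i)) (not_lt.2 hst.le)
        subst hi
        have e1 : A i k ≤ S := Finset.single_le_sum (fun j _ => hA i j) (Finset.mem_univ k)
        have e2 := mul_le_mul_of_nonneg_right hNL (hb i).le
        have e3 : S ≤ S * δ := le_mul_of_one_le_right hS0 hδ
        have : 0 ≤ C / p i * δ := by positivity
        linarith
    refine ⟨?_, Or.inr ⟨rfl, ?_⟩⟩
    · have e1 : a * (N * ξ j) - (C / p i₀ + S + S * R) * δ ≤ a * x j := by
        have := hs.binding
        have : a * (N * ξ j) = N * b i₀ := by rw [← this]; ring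
        linarith
      have e2 : N * ξ j - (C / p i₀ + S + S * R) / a * δ ≤ x j := by
        refine le_of_mul_le_mul_left (le_trans (le_of_eq ?_) e1) ha0
        field_simp
      linarith
    · refine le_of_mul_le_mul_left (a := a) ?_ ha0
      have e1 : a * x j ≤ ∑ k, A i₀ k * x k := Finset.single_le_sum
        (f := fun k => A i₀ k * x k) (fun k _ => mul_nonneg (hA i₀ k) (hx0 k)) (Finset.mem_univ j)
      have e2 := hcap i₀
      have e3 : a * (L * ξ j) = L * b i₀ := by rw [← hs.binding]; ring
      linarith
  · have e1 := hxj j hj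
    have e2 := hx0 j
    rw [(hs.other j hj).1, mul_zero]
    refine ⟨by linarith, Or.inl (by linarith)⟩

/-- The estimates for `FF` that hold in every fluid program. Types outside `S` follow the fluid
solution; for types in `S` the hindsight solution uses up the capacity that `FF` cannot exceed. -/
theorem FluidPair.exists_ff_estimate [NeZero m] (h : FluidPair r A lam b p ξ)
    (hr : ∀ j, 0 < r j) (hA : ∀ i j, 0 ≤ A i j) (hA' : ∀ j, ∃ i, A i j ≠ 0)
    (hb : ∀ i, 0 < b i) (hgp : GeneralPosition r A) (hM : 0 < thetaBar r A b) :
    ∃ (K : ℝ) (S : Set (Fin n)), 0 < K ∧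
      (∀ (L : ℝ) (v z : Fin n → ℝ), 0 ≤ L → (∀ j, 0 ≤ v j) →
        IsLPOptimal r A (fun i => L * b i) v z → ∀ j ∈ S, L * ξ j ≤ v j → L * ξ j ≤ z j) ∧
      ∀ (L δ : ℝ) (t₁ N : ℕ) (X : ℕ → Fin n), 0 < L → N ≤ L → √(N : ℝ) ≤ δ →
      1 ≤ δ → FFQuiet r A lam (fun i => L * b i) L t₁ X N δ →
      ∀ j, N * ξ j - K * δ ≤ ffCount r A (fun i => L * b i) L t₁ X N j ∧
        (ffCount r A (fun i => L * b i) L t₁ X N j ≤ N * ξ j + K * δ ∨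
          j ∈ S ∧ ffCount r A (fun i => L * b i) L t₁ X N j ≤ L * ξ j) := by
  have hr0 : ∀ j, 0 ≤ r j := fun j => (hr j).le
  by_cases hp : ∀ i, p i < thetaBar r A b
  · obtain ⟨K, hK, hbd⟩ := h.exists_ff_bound hr0 hA hb hgp hM hp
    refine ⟨K, ∅, hK, fun _ _ _ _ _ _ j hj => absurd hj (Set.notMem_empty j),
      fun L δ t₁ N X hL hNL hN hδ hquiet j => ?_⟩
    have := abs_le.1 (hbd L δ t₁ N X hL hNL hN hδ hquiet j)
    exact ⟨by linarith, Or.inl (by linarith)⟩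
  · push Not at hp
    obtain ⟨i₀, hi₀⟩ := hp
    obtain ⟨j₀, hs⟩ := h.exists_singleType hr hA hA' hb hgp hM hi₀
    obtain ⟨K, hK, hbd⟩ := hs.exists_ff_bound h hr0 hA hb hM
    refine ⟨K, {j₀}, hK, fun L v z hL hv hz j hj hle => ?_, hbd⟩
    rw [Set.mem_singleton_iff] at hj
    subst hj
    exact hs.le_hindsight h hL hv hz hle

end NRM

/-! ### From quiet paths to the event `E` -/

namespace NRM

variable {m n : ℕ} {r : Fin n → ℝ} {A : Matrix (Fin m) (Fin n) ℝ} {lam : Fin n → ℝ}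
  {b p : Fin m → ℝ} {ξ : Fin n → ℝ}

/-- The relation `t + 1 = s + N` avoids truncated subtraction and includes the empty range `t + 1 =
s`. -/
theorem sum_Icc_eq_sum_range (f : ℕ → ℝ) {s t N : ℕ} (h : t + 1 = s + N) :
    ∑ u ∈ Finset.Icc s t, f u = ∑ u ∈ Finset.range N, f (s + u) := by
  have h1 : Finset.Icc s t = Finset.Ico s (s + N) := by
    ext u; simp only [Finset.mem_Icc, Finset.mem_Ico]; omega
  rw [h1, Finset.sum_Ico_eq_sum_range, Nat.add_sub_cancel_left]

open Classical in
theorem card_ffAccepts_eq_ffCount {B : Fin m → ℝ} {L : ℝ} {s t N : ℕ} {X : ℕ → Fin n}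
    (h : t + 1 = s + N) (j : Fin n) :
    (((Finset.Icc s t).filter (fun u => X u = j ∧ ffAccepts r A B L s X u)).card : ℝ)
      = ffCount r A B L s X N j := by
  rw [Finset.card_filter, Nat.cast_sum, ffCount, sum_Icc_eq_sum_range _ h]
  refine Finset.sum_congr rfl fun u _ => ?_
  rw [ffDecision, ffAccepts, Nat.add_sub_cancel_left, ite_and]
  push_cast
  rfl

theorem arrivals_eq_sum {s t N : ℕ} {X : ℕ → Fin n} (h : t + 1 = s + N) (j : Fin n) :
    (arrivals X s t j : ℝ) = ∑ u ∈ Finset.range N, if X (s + u) = j then 1 else 0 := by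
  rw [arrivals, Finset.card_filter, Nat.cast_sum, sum_Icc_eq_sum_range _ h]
  simp

theorem arrivals_sub_eq_sum {s t N : ℕ} {X : ℕ → Fin n} (h : t + 1 = s + N) (j : Fin n) :
    (arrivals X s t j : ℝ) - N * lam j
      = ∑ u ∈ Finset.range N, ((if X (s + u) = j then 1 else 0) - lam j) := by
  rw [arrivals_eq_sum h, Finset.sum_sub_distrib, Finset.sum_const, Finset.card_range, nsmul_eq_mul]

theorem arrivals_add {s t u : ℕ} {X : ℕ → Fin n} (hst : s ≤ t) (htu : t ≤ u + 1) (ht : 0 < t)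
    (j : Fin n) : arrivals X s u j = arrivals X s (t - 1) j + arrivals X t u j := by
  have h1 : Finset.Icc s u = Finset.Icc s (t - 1) ∪ Finset.Icc t u := by
    ext v; simp only [Finset.mem_union, Finset.mem_Icc]; omega
  have h2 : Disjoint (Finset.Icc s (t - 1)) (Finset.Icc t u) := by
    rw [Finset.disjoint_left]; intro v; simp only [Finset.mem_Icc]; omega
  rw [arrivals, arrivals, arrivals, h1, Finset.filter_union,
    Finset.card_union_of_disjoint (Finset.disjoint_filter_filter h2)]

theorem phase1Count_eq {C : Fin m → ℝ} {T : ℕ} {α : ℝ} {X : ℕ → Fin n}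
    (hC : ∀ i, C i * ((len1 T α : ℝ) / T) = len1 T α * b i) (j : Fin n) :
    (phase1Count r A C T α X j : ℝ)
      = ffCount r A (fun i => len1 T α * b i) (len1 T α) 1 X (len1 T α) j := by
  rw [phase1Count, card_ffAccepts_eq_ffCount (N := len1 T α) (by ring)]
  simp only [hC]

theorem phase2CountUncapped_eq_zero {C : Fin m → ℝ} {T : ℕ} {α β γ : ℝ} {X : ℕ → Fin n}
    {j : Fin n} (h : InReject r A lam C T α γ X j) :
    phase2CountUncapped r A lam C T α β γ X j = 0 := by
  classical
  rw [phase2CountUncapped, Finset.card_eq_zero, Finset.filter_eq_empty_iff]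
  rintro t - ⟨rfl, h1⟩
  exact h1.1 h

theorem phase2CountUncapped_eq_arrivals {C : Fin m → ℝ} {T : ℕ} {α β γ : ℝ} {X : ℕ → Fin n}
    {j : Fin n} (h : InAccept r A lam C T α γ X j) :
    phase2CountUncapped r A lam C T α β γ X j
      = arrivals X (start2 T α) (start3 T α β - 1) j := by
  classical
  rw [phase2CountUncapped, arrivals]
  congr 1
  refine Finset.filter_congr fun t _ => ⟨fun h1 => h1.1, ?_⟩
  rintro rfl
  exact ⟨rfl, h.1, Or.inl h⟩

/-- The subroutine sees all arrivals with its own capacity, so the overriding decisions for other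
types do not disturb its trajectory. -/
theorem phase2CountUncapped_eq_ffCount {C : Fin m → ℝ} {T : ℕ} {α β γ : ℝ} {X : ℕ → Fin n}
    {j : Fin n} (hR : ¬ InReject r A lam C T α γ X j) (hAcc : ¬ InAccept r A lam C T α γ X j)
    (hC : ∀ i, phase2Capacity C T α i = (T - len1 T α) * b i) :
    (phase2CountUncapped r A lam C T α β γ X j : ℝ)
      = ffCount r A (fun i => (T - len1 T α) * b i) (T - len1 T α) (len1 T α + 1) X
          (len2 T α β) j := by
  classical
  have h2 : phase2Capacity C T α = fun i => (T - len1 T α) * b i := funext hC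
  have h1 : phase2CountUncapped r A lam C T α β γ X j
      = ((Finset.Icc (len1 T α + 1) (len1 T α + len2 T α β)).filter (fun u => X u = j ∧
        ffAccepts r A (phase2Capacity C T α) (T - len1 T α) (len1 T α + 1) X u)).card := by
    rw [phase2CountUncapped]
    congr 1
    ext t
    simp only [Finset.mem_filter]
    refine and_congr Iff.rfl (and_congr_right ?_)
    rintro rfl
    exact ⟨fun h => h.2.resolve_left hAcc, fun h => ⟨hR, Or.inr h⟩⟩
  rw [h1, card_ffAccepts_eq_ffCount (N := len2 T α β) (by ring), h2]

theorem exists_pos_le_of_pos {ι : Type*} [Fintype ι] (f : ι → ℝ) :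
    ∃ κ : ℝ, 0 < κ ∧ ∀ j, 0 < f j → κ ≤ f j := by
  classical
  rcases (Finset.univ.filter fun j => 0 < f j).eq_empty_or_nonempty with h | h
  · refine ⟨1, one_pos, fun j hj => ?_⟩
    have : j ∈ Finset.univ.filter fun j => 0 < f j := by simpa
    simp [h] at this
  · obtain ⟨j, hj, hmin⟩ := Finset.exists_min_image _ f h
    exact ⟨f j, (Finset.mem_filter.1 hj).2, fun i hi => hmin i (by simpa)⟩

/-- On a path with little noise, the hindsight solution can still be followed after phase II. -/
theorem FluidPair.exists_goodPath [NeZero m] (h : FluidPair r A lam b p ξ)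
    (hr : ∀ j, 0 < r j) (hA : ∀ i j, 0 ≤ A i j) (hA' : ∀ j, ∃ i, A i j ≠ 0)
    (hb : ∀ i, 0 < b i) (hgp : GeneralPosition r A) (hM : 0 < thetaBar r A b)
    (hlam : ∀ j, lam j ≤ 1) :
    ∃ K κ : ℝ, 0 < K ∧ 0 < κ ∧ ∀ (C : Fin m → ℝ) (T : ℕ) (α β γ δ₁ δ₂ : ℝ) (X : ℕ → Fin n)
      (z : Fin n → ℝ),
      (∀ i, C i = T * b i) → 0 < T → 0 < len1 T α → len1 T α < T →
      len1 T α + len2 T α β ≤ T →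
      (T : ℝ) ^ α ≤ len1 T α → len1 T α ≤ (T : ℝ) ^ α + 1 →
      √(len1 T α : ℝ) ≤ δ₁ → 1 ≤ δ₁ → √(len2 T α β : ℝ) ≤ δ₂ → 1 ≤ δ₂ →
      K * δ₁ < κ * (T : ℝ) ^ (α / 2 + γ) →
      1 + K * δ₁ + (T : ℝ) ^ (α / 2 + γ) ≤ κ * (T : ℝ) ^ α →
      K * δ₂ ≤ κ * ((T : ℝ) - len1 T α - len2 T α β) →
      FFQuiet r A lam (fun i => (len1 T α : ℝ) * b i) (len1 T α) 1 X (len1 T α) δ₁ →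
      FFQuiet r A lam (fun i => ((T : ℝ) - len1 T α) * b i) ((T : ℝ) - len1 T α) (len1 T α + 1) X
        (len2 T α β) δ₂ →
      (∀ j, |∑ u ∈ Finset.range (T - len1 T α),
        ((if X (len1 T α + 1 + u) = j then 1 else 0) - lam j)| ≤ δ₂) →
      (∀ j, |∑ u ∈ Finset.range (len2 T α β),
        ((if X (len1 T α + 1 + u) = j then 1 else 0) - lam j)| ≤ δ₂) →
      (∀ j, lam j = 0 → ∀ t, X t ≠ j) →
      IsHindsightOptimal r A C T α X z → GoodPath r A lam C T α β γ X z := by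
  have hr0 : ∀ j, 0 ≤ r j := fun j => (hr j).le
  obtain ⟨K₁, S, hK₁, hS, hff⟩ := h.exists_ff_estimate hr hA hA' hb hgp hM
  obtain ⟨K₂, hK₂, hhind⟩ := h.exists_hindsight_bound hr0 hA hgp
  obtain ⟨κ₁, hκ₁, hκlam⟩ := exists_pos_le_of_pos lam
  obtain ⟨κ₂, hκ₂, hκξ⟩ := exists_pos_le_of_pos ξ
  obtain ⟨κ₃, hκ₃, hκd⟩ := exists_pos_le_of_pos fun j => lam j - ξ j
  -- The summand `2` absorbs two arrival deviations of size `δ₂`; `κ` is a lower bound for all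
  -- positive values among `lam j`, `ξ j` and `lam j - ξ j`.
  refine ⟨K₁ + K₂ + 2, min κ₁ (min κ₂ κ₃), by positivity, by positivity, ?_⟩
  intro C T α β γ δ₁ δ₂ X z hC hT hl1 hl1T hl2T hTa hTa' hs1 hδ₁ hs2 hδ₂ hn1 hn2 hn3 hq1 hq2
    hΛ1 hΛ2 hnull hz j
  set κ := min κ₁ (min κ₂ κ₃) with hκ
  have hκ0 : 0 < κ := by positivity
  set l1 := len1 T α with hl1d
  set l2 := len2 T α β with hl2d
  set Ta := (T : ℝ) ^ α with hTad
  set Tc := (T : ℝ) ^ (α / 2 + γ) with hTcd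
  have hT' : (0 : ℝ) < T := by exact_mod_cast hT
  have hl1' : (0 : ℝ) < l1 := by exact_mod_cast hl1
  have hL2 : (0 : ℝ) < T - l1 := sub_pos.2 (by exact_mod_cast hl1T)
  have hl2' : (l2 : ℝ) ≤ T - l1 := by
    have : (l1 : ℝ) + l2 ≤ T := by exact_mod_cast hl2T
    linarith
  have hl2nn : (0 : ℝ) ≤ l2 := Nat.cast_nonneg _
  have hTa0 : 0 ≤ Ta := by positivity
  have hTc0 : 0 ≤ Tc := by positivity
  have hcap1 : ∀ i, C i * ((l1 : ℝ) / T) = l1 * b i := fun i => by rw [hC]; field_simp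
  have hcap2 : ∀ i, phase2Capacity C T α i = (T - l1) * b i := fun i => by
    rw [phase2Capacity, hC]; field_simp; rw [hl1d]
  have hx := hff l1 δ₁ 1 l1 X hl1' le_rfl hs1 hδ₁ hq1 j
  rw [← phase1Count_eq (r := r) (A := A) hcap1] at hx
  have hx2 := hff (T - l1) δ₂ (l1 + 1) l2 X hL2 hl2' hs2 hδ₂ hq2 j
  have ha1 : ∀ j, (arrivals X (start2 T α) T j : ℝ) - (T - l1) * lam j
      = ∑ u ∈ Finset.range (T - l1), ((if X (l1 + 1 + u) = j then 1 else 0) - lam j) := fun j => by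
    rw [← Nat.cast_sub hl1T.le]
    exact arrivals_sub_eq_sum (by simp only [start2]; omega) j
  have ha2 : (arrivals X (start2 T α) (start3 T α β - 1) j : ℝ) - l2 * lam j
      = ∑ u ∈ Finset.range l2, ((if X (l1 + 1 + u) = j then 1 else 0) - lam j) :=
    arrivals_sub_eq_sum (by simp only [start2, start3]; omega) j
  have hadd : (arrivals X (start2 T α) T j : ℝ) = arrivals X (start2 T α) (start3 T α β - 1) j
      + arrivals X (start3 T α β) T j := by
    exact_mod_cast arrivals_add (by simp only [start2, start3]; omega)
      (by simp only [start3]; omega) (by simp only [start3]; omega) j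
  have hzopt : IsLPOptimal r A (fun i => ((T : ℝ) - l1) * b i)
      (fun j => (arrivals X (start2 T α) T j : ℝ)) z := by
    rw [← funext hcap2]; exact hz
  have hΛ1' : ∀ j, |(arrivals X (start2 T α) T j : ℝ) - (T - l1) * lam j| ≤ δ₂ := fun j => by
    rw [ha1]; exact hΛ1 j
  have hzj := abs_le.1 (hhind (T - l1) δ₂ _ z hL2.le (by linarith) (fun j => Nat.cast_nonneg _)
    hΛ1' hzopt j)
  have hzv := hzopt.1.2 j
  have hΛ1j := abs_le.1 (hΛ1' j)
  have hΛ2j := abs_le.1 (ha2 ▸ hΛ2 j)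
  have hSj := hS (T - l1) _ z hL2.le (fun j => Nat.cast_nonneg _) hzopt j
  have hξ0 := h.nonneg j
  have hξ1 := h.le j
  -- Types of probability zero do not arrive on the path, so all quantities in the window vanish.
  rcases (hξ0.trans hξ1).eq_or_lt with hl0 | hlpos
  · have hno := hnull j hl0.symm
    have e0 : ∀ s t, arrivals X s t j = 0 := fun s t => by
      rw [arrivals, Finset.card_eq_zero, Finset.filter_eq_empty_iff]
      exact fun u _ => hno u
    have e1 : phase2CountUncapped r A lam C T α β γ X j = 0 := by
      classical
      rw [phase2CountUncapped, Finset.card_eq_zero, Finset.filter_eq_empty_iff]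
      exact fun u _ hu => hno u hu.1
    simp only [e0, Nat.cast_zero] at hzv
    rw [e0, e1]
    simpa using ⟨hzv.1, hzv.2⟩
  have hκl : κ ≤ lam j := (min_le_left _ _).trans (hκlam j hlpos)
  have hκξ' : 0 < ξ j → κ ≤ ξ j := fun hh =>
    (min_le_right _ _).trans ((min_le_left _ _).trans (hκξ j hh))
  have hκd' : ξ j < lam j → κ ≤ lam j - ξ j := fun hh =>
    (min_le_right _ _).trans ((min_le_right _ _).trans (hκd j (sub_pos.2 hh)))
  set W : ℝ := T - l1 - l2 with hW
  have hW0 : 0 ≤ W := by linarith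
  have hlamj := hlam j
  have hKδ₁ : 0 ≤ K₁ * δ₁ := by positivity
  have hKδ₂ : 0 ≤ K₁ * δ₂ := by positivity
  have hKδ₂' : 0 ≤ K₂ * δ₂ := by positivity
  have hKδ₁' : 0 ≤ K₂ * δ₁ := by positivity
  have hxup : (phase1Count r A C T α X j : ℝ) ≤ l1 * ξ j + K₁ * δ₁ := by
    rcases hx.2 with hh | ⟨-, hh⟩ <;> linarith
  have hκTc : κ * Tc ≤ lam j * Tc := mul_le_mul_of_nonneg_right hκl hTc0
  have hlTc : lam j * Tc ≤ Tc := mul_le_of_le_one_left hTc0 hlamj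
  have hκW : κ * W ≤ lam j * W := mul_le_mul_of_nonneg_right hκl hW0
  have hWlam : lam j * W = (T - l1) * lam j - l2 * lam j := by rw [hW]; ring
  have hWξ : ξ j * W = (T - l1) * ξ j - l2 * ξ j := by rw [hW]; ring
  -- Rejected types have `ξ j = 0`, since otherwise phase I would have accepted about `κ T^α` of
  -- them. Then `z j = O(δ₂)`, which the arrivals of phase III cover.
  by_cases hR : InReject r A lam C T α γ X j
  · have hξz : ξ j = 0 := by
      by_contra hc
      have e1 : κ * Ta ≤ ξ j * l1 :=
        mul_le_mul (hκξ' (lt_of_le_of_ne hξ0 (Ne.symm hc))) hTa hTa0 hξ0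
      have e2 : (phase1Count r A C T α X j : ℝ) < lam j * Tc := hR
      linarith [hx.1]
    rw [phase2CountUncapped_eq_zero hR]
    rw [hξz] at hzj
    refine ⟨by simpa using hzv.1, ?_⟩
    push_cast
    linarith
  -- Accepted types have `ξ j = lam j`. The hindsight solution then serves nearly all arrivals,
  -- hence at least those of phase II.
  by_cases hAcc : InAccept r A lam C T α γ X j
  · have hξl : ξ j = lam j := by
      by_contra hc
      have hlt : ξ j < lam j := lt_of_le_of_ne hξ1 hc
      have e1 : κ * Ta ≤ (lam j - ξ j) * Ta := mul_le_mul_of_nonneg_right (hκd' hlt) hTa0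
      have e2 : lam j * (Ta - Tc) < (phase1Count r A C T α X j : ℝ) := hAcc.2
      have e3 : l1 * ξ j ≤ (Ta + 1) * ξ j := mul_le_mul_of_nonneg_right hTa' hξ0
      linarith
    rw [phase2CountUncapped_eq_arrivals hAcc]
    rw [hξl] at hzj
    exact ⟨by linarith, by rw [← hadd]; exact hzv.2⟩
  have hRx : lam j * Tc ≤ (phase1Count r A C T α X j : ℝ) := not_lt.1 hR
  have hAx : (phase1Count r A C T α X j : ℝ) ≤ lam j * (Ta - Tc) := by
    by_contra hc
    exact hAcc ⟨hR, not_le.1 hc⟩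
  -- An unclassified type has `0 < ξ j < lam j`, both gaps being at least `κ`, so the length `W` of
  -- the remaining horizon gives room on both sides.
  have hξpos : 0 < ξ j := by
    refine lt_of_le_of_ne hξ0 fun hc => ?_
    rw [← hc] at hxup
    linarith
  have hξlt : ξ j < lam j := by
    refine lt_of_le_of_ne hξ1 fun hc => ?_
    have e1 : Ta * lam j ≤ l1 * lam j := mul_le_mul_of_nonneg_right hTa hlpos.le
    rw [hc] at hx
    linarith [hx.1]
  have hκWξ : κ * W ≤ ξ j * W := mul_le_mul_of_nonneg_right (hκξ' hξpos) hW0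
  have hκWd : κ * W ≤ (lam j - ξ j) * W := mul_le_mul_of_nonneg_right (hκd' hξlt) hW0
  rw [phase2CountUncapped_eq_ffCount hR hAcc hcap2]
  constructor
  · rcases hx2.2 with hh | ⟨hjS, hh⟩
    · linarith
    -- In the degenerate case `FF` may exceed `l2 * ξ j`, but not `(T - l1) * ξ j`, which the
    -- hindsight solution reaches.
    · refine hh.trans (hSj hjS ?_)
      have : κ * W ≤ (lam j - ξ j) * (T - l1) :=
        hκWd.trans (mul_le_mul_of_nonneg_left (by linarith) (by linarith))
      linarith
  · linarith [hx2.1]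

end NRM

namespace NRM

/-! ### Concentration of predictable noise -/

/-- Hoeffding's lemma for a finite distribution. -/
theorem sum_mul_exp_le {ι : Type*} [Fintype ι] {w h : ι → ℝ} {c : ℝ} (hw : ∀ j, 0 ≤ w j)
    (hw1 : ∑ j, w j = 1) (hc : 0 < c) (hh : ∀ j, |h j| ≤ c) (hmean : ∑ j, w j * h j = 0) (s : ℝ) :
    ∑ j, w j * Real.exp (s * h j) ≤ Real.exp (c ^ 2 * s ^ 2 / 2) := by
  have key : ∀ j, Real.exp (s * h j) ≤ Real.cosh (s * c) + h j / c * Real.sinh (s * c) := by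
    intro j
    obtain ⟨h1, h2⟩ := abs_le.1 (hh j)
    have h3 : -1 ≤ h j / c := by rw [le_div_iff₀ hc]; linarith
    have h4 : h j / c ≤ 1 := by rw [div_le_iff₀ hc]; linarith
    have := convexOn_exp.2 (Set.mem_univ (s * c)) (Set.mem_univ (-(s * c)))
      (show 0 ≤ (1 + h j / c) / 2 by linarith) (show 0 ≤ (1 - h j / c) / 2 by linarith) (by ring)
    simp only [smul_eq_mul] at this
    have e : (1 + h j / c) / 2 * (s * c) + (1 - h j / c) / 2 * (-(s * c)) = s * h j := by
      field_simp; ring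
    rw [e] at this
    rw [Real.cosh_eq, Real.sinh_eq]
    linarith
  calc ∑ j, w j * Real.exp (s * h j)
      ≤ ∑ j, w j * (Real.cosh (s * c) + h j / c * Real.sinh (s * c)) :=
        Finset.sum_le_sum fun j _ => mul_le_mul_of_nonneg_left (key j) (hw j)
    _ = (∑ j, w j) * Real.cosh (s * c) + (∑ j, w j * h j) * (Real.sinh (s * c) / c) := by
        rw [Finset.sum_mul, Finset.sum_mul, ← Finset.sum_add_distrib]
        exact Finset.sum_congr rfl fun j _ => by ring
    _ = Real.cosh (s * c) := by rw [hw1, hmean]; ring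
    _ ≤ Real.exp ((s * c) ^ 2 / 2) := Real.cosh_le_exp_half_sq _
    _ = _ := by ring_nf

/-- `F` depends on the path only through the periods before `M`. -/
def DependsOnPast {S R : Type*} (F : (ℕ → S) → R) (M : ℕ) : Prop :=
  ∀ x y : ℕ → S, (∀ s, s < M → x s = y s) → F x = F y

theorem DependsOnPast.exists_factor {S R : Type*} [Nonempty S] {F : (ℕ → S) → R} {M : ℕ}
    (hF : DependsOnPast F M) :
    ∃ φ : (Finset.range M → S) → R, ∀ x, F x = φ fun i => x i := by
  classical
  refine ⟨fun v => F fun s => if h : s ∈ Finset.range M then v ⟨s, h⟩ else Classical.arbitrary S,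
    fun x => hF _ _ fun s hs => ?_⟩
  rw [dif_pos (Finset.mem_range.2 hs)]

variable {n : ℕ} {lam : Fin n → ℝ} {Ω : Type*} [MeasurableSpace Ω] {P : Measure Ω}
  {X : ℕ → Ω → Fin n}

theorem DependsOnPast.integrable [IsProbabilityMeasure P]
    [Nonempty (Fin n)] {F : (ℕ → Fin n) → ℝ} {M : ℕ}
    (hF : DependsOnPast F M) (hXm : ∀ t, Measurable (X t)) :
    Integrable (fun ω => F fun t => X t ω) P := by
  obtain ⟨φ, hφ⟩ := hF.exists_factor
  have hmeas : Measurable fun ω => fun i : Finset.range M => X i ω :=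
    measurable_pi_lambda _ fun i => hXm i
  have h1 : Integrable φ (P.map fun ω => fun i : Finset.range M => X i ω) := by
    have := Measure.isProbabilityMeasure_map (μ := P) hmeas.aemeasurable
    exact Integrable.of_finite
  simp only [hφ]
  exact h1.comp_measurable hmeas

theorem integral_indicator_mul [Nonempty (Fin n)] {F : (ℕ → Fin n) → ℝ} {M : ℕ}
    (hF : DependsOnPast F M) (hXm : ∀ t, Measurable (X t)) (hXi : iIndepFun X P)
    (hXl : ∀ t j, P.real {ω | X t ω = j} = lam j) (j : Fin n) :
    ∫ ω, (if X M ω = j then 1 else 0) * F (fun t => X t ω) ∂P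
      = lam j * ∫ ω, F (fun t => X t ω) ∂P := by
  obtain ⟨φ, hφ⟩ := hF.exists_factor
  have hind := (hXi.indepFun_finset {M} (Finset.range M) (by simp) hXm).comp
    (φ := fun v => if v ⟨M, Finset.mem_singleton_self M⟩ = j then (1 : ℝ) else 0) (ψ := φ)
    .of_discrete .of_discrete
  have hmeas : Measurable fun ω => fun i : Finset.range M => X i ω :=
    measurable_pi_lambda _ fun i => hXm i
  have hmeas1 : Measurable fun ω => if X M ω = j then (1 : ℝ) else 0 :=
    (Measurable.of_discrete (f := fun i : Fin n => if i = j then (1 : ℝ) else 0)).comp (hXm M)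
  have h1 := hind.integral_fun_mul_eq_mul_integral hmeas1.aestronglyMeasurable
    ((Measurable.of_discrete (f := φ)).comp hmeas).aestronglyMeasurable
  simp only [Function.comp_def] at h1
  simp only [hφ]
  rw [h1]
  congr 1
  have h2 : (fun ω => if X M ω = j then (1 : ℝ) else 0) = {ω | X M ω = j}.indicator 1 := by
    ext ω; simp [Set.indicator_apply]
  have h3 : MeasurableSet {ω | X M ω = j} := hXm M (measurableSet_singleton j)
  rw [h2, integral_indicator_one h3, hXl]

/-- The last period is split off by expanding over its type, which is independent of the past;
Hoeffding's lemma then holds pointwise in the past. The first conjunct supplies integrability, a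
function of finitely many discrete variables being integrable. -/
theorem integral_exp_sum_le [IsProbabilityMeasure P]
    (hXm : ∀ t, Measurable (X t)) (hXi : iIndepFun X P)
    (hXl : ∀ t j, P.real {ω | X t ω = j} = lam j) (hlam0 : ∀ j, 0 ≤ lam j)
    (hlam1 : ∑ j, lam j = 1) {H : ℕ → (ℕ → Fin n) → Fin n → ℝ} {t₀ : ℕ}
    (hdep : ∀ u, DependsOnPast (H u) (t₀ + u)) {c : ℝ} (hc : 0 < c)
    (hmean : ∀ u x, ∑ j, lam j * H u x j = 0) (hbd : ∀ u x j, |H u x j| ≤ c) (s : ℝ) (N : ℕ) :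
    DependsOnPast (fun x => Real.exp (s * ∑ u ∈ Finset.range N, H u x (x (t₀ + u)))) (t₀ + N) ∧
    ∫ ω, Real.exp (s * ∑ u ∈ Finset.range N, H u (fun t => X t ω) (X (t₀ + u) ω)) ∂P
      ≤ Real.exp (c ^ 2 * s ^ 2 / 2) ^ N := by
  have : Nonempty (Fin n) := by
    rcases n with - | n
    · simp at hlam1
    · infer_instance
  have hpast : ∀ N, DependsOnPast
      (fun x => Real.exp (s * ∑ u ∈ Finset.range N, H u x (x (t₀ + u)))) (t₀ + N) := by
    intro N x y hxy
    have : ∀ u ∈ Finset.range N, H u x (x (t₀ + u)) = H u y (y (t₀ + u)) := fun u hu => by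
      have hu := Finset.mem_range.1 hu
      rw [hdep u x y fun t ht => hxy t (by omega), hxy (t₀ + u) (by omega)]
    simp only [Finset.sum_congr rfl this]
  refine ⟨hpast N, ?_⟩
  induction N with
  | zero => simp
  | succ N ih =>
    let E : (ℕ → Fin n) → ℝ := fun x =>
      Real.exp (s * ∑ u ∈ Finset.range N, H u x (x (t₀ + u)))
    let Ψ : Fin n → (ℕ → Fin n) → ℝ := fun j x => E x * Real.exp (s * H N x j)
    have hΨ : ∀ j, DependsOnPast (Ψ j) (t₀ + N) := fun j x y hxy => by
      have h1 : E x = E y := hpast N x y hxy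
      simp only [Ψ]
      rw [h1, hdep N x y hxy]
    have h1 : ∀ ω, Real.exp (s * ∑ u ∈ Finset.range (N + 1),
          H u (fun t => X t ω) (X (t₀ + u) ω))
        = ∑ j, (if X (t₀ + N) ω = j then 1 else 0) * Ψ j (fun t => X t ω) := fun ω => by
      simp only [ite_mul, one_mul, zero_mul, Finset.sum_ite_eq, Finset.mem_univ, if_true, Ψ, E]
      rw [Finset.sum_range_succ, mul_add, Real.exp_add]
    have hint : ∀ j, Integrable
        (fun ω => (if X (t₀ + N) ω = j then 1 else 0) * Ψ j (fun t => X t ω)) P := fun j => by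
      refine DependsOnPast.integrable (M := t₀ + N + 1)
        (F := fun x => (if x (t₀ + N) = j then 1 else 0) * Ψ j x) (fun x y hxy => ?_) hXm
      simp only
      rw [hxy _ (Nat.lt_succ_self _), hΨ j x y fun t ht => hxy t (by omega)]
    simp only [h1]
    rw [integral_finsetSum _ fun j _ => hint j]
    simp only [integral_indicator_mul (hΨ _) hXm hXi hXl]
    have h2 : ∑ j, lam j * ∫ ω, Ψ j (fun t => X t ω) ∂P
        = ∫ ω, ∑ j, lam j * Ψ j (fun t => X t ω) ∂P := by
      rw [integral_finsetSum _ fun j _ => ((hΨ j).integrable hXm).const_mul _]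
      simp only [integral_const_mul]
    rw [h2, pow_succ]
    calc ∫ ω, ∑ j, lam j * Ψ j (fun t => X t ω) ∂P
        ≤ ∫ ω, E (fun t => X t ω) * Real.exp (c ^ 2 * s ^ 2 / 2) ∂P := by
          refine integral_mono (integrable_finsetSum _ fun j _ =>
            ((hΨ j).integrable hXm).const_mul _)
            (((hpast N).integrable hXm).mul_const _) fun ω => ?_
          have h3 := sum_mul_exp_le hlam0 hlam1 hc (hbd N fun t => X t ω)
            (hmean N fun t => X t ω) s
          have h4 := mul_le_mul_of_nonneg_left h3 (Real.exp_pos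
            (s * ∑ u ∈ Finset.range N, H u (fun t => X t ω) (X (t₀ + u) ω))).le
          refine le_trans (le_of_eq ?_) h4
          rw [Finset.mul_sum]
          exact Finset.sum_congr rfl fun j _ => by simp only [Ψ, E]; ring
      _ ≤ Real.exp (c ^ 2 * s ^ 2 / 2) ^ N * Real.exp (c ^ 2 * s ^ 2 / 2) := by
          rw [integral_mul_const]
          exact mul_le_mul_of_nonneg_right ih (Real.exp_pos _).le

/-- The Azuma–Hoeffding inequality for predictable functions of independent arrivals. -/
theorem measure_sum_ge_le [IsProbabilityMeasure P]
    (hXm : ∀ t, Measurable (X t)) (hXi : iIndepFun X P)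
    (hXl : ∀ t j, P.real {ω | X t ω = j} = lam j) (hlam0 : ∀ j, 0 ≤ lam j)
    (hlam1 : ∑ j, lam j = 1) {H : ℕ → (ℕ → Fin n) → Fin n → ℝ} {t₀ : ℕ}
    (hdep : ∀ u, DependsOnPast (H u) (t₀ + u)) {c : ℝ} (hc : 0 < c)
    (hmean : ∀ u x, ∑ j, lam j * H u x j = 0) (hbd : ∀ u x j, |H u x j| ≤ c) {N : ℕ} {V δ : ℝ}
    (hV : 0 < V) (hNV : c ^ 2 * N ≤ V) (hδ : 0 ≤ δ) :
    P.real {ω | δ ≤ ∑ u ∈ Finset.range N, H u (fun t => X t ω) (X (t₀ + u) ω)}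
      ≤ Real.exp (-(δ ^ 2 / (2 * V))) := by
  have : Nonempty (Fin n) := by
    rcases n with - | n
    · simp at hlam1
    · infer_instance
  -- The minimiser of the Chernoff exponent `-s * δ + V * s ^ 2 / 2`.
  set s := δ / V with hs
  obtain ⟨h1, h2⟩ := integral_exp_sum_le hXm hXi hXl hlam0 hlam1 hdep hc hmean hbd s N
  refine (measure_ge_le_exp_mul_mgf δ (div_nonneg hδ hV.le) (h1.integrable hXm)).trans ?_
  rw [mgf]
  calc Real.exp (-s * δ) *
        ∫ ω, Real.exp (s * ∑ u ∈ Finset.range N, H u (fun t => X t ω) (X (t₀ + u) ω)) ∂P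
      ≤ Real.exp (-s * δ) * Real.exp (c ^ 2 * s ^ 2 / 2) ^ N :=
        mul_le_mul_of_nonneg_left h2 (Real.exp_pos _).le
    _ = Real.exp (-s * δ + c ^ 2 * N * (s ^ 2 / 2)) := by
        rw [← Real.exp_nat_mul, ← Real.exp_add]; ring_nf
    _ ≤ Real.exp (-s * δ + V * (s ^ 2 / 2)) := by gcongr
    _ = Real.exp (-(δ ^ 2 / (2 * V))) := by
        congr 1; rw [hs]; field_simp; ring

/-! ### The noise of `FF` -/

variable {m : ℕ} {r : Fin n → ℝ} {A : Matrix (Fin m) (Fin n) ℝ}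

theorem ffState_dependsOnPast (B : Fin m → ℝ) (L : ℝ) (t₁ u : ℕ) :
    DependsOnPast (fun X => ffState r A B L t₁ X u) (t₁ + u) := by
  induction u with
  | zero => intro x y _; rfl
  | succ u ih =>
    intro x y hxy
    have h : ffState r A B L t₁ x u = ffState r A B L t₁ y u :=
      ih x y fun t ht => hxy t (by omega)
    simp only [ffState]
    rw [h, hxy (t₁ + u) (by omega)]

theorem rewardNoise_dependsOnPast (B : Fin m → ℝ) (L : ℝ) (t₁ u : ℕ) :
    DependsOnPast (rewardNoise r A lam B L t₁ u) (t₁ + u) := by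
  intro x y hxy
  have h : ffState r A B L t₁ x u = ffState r A B L t₁ y u :=
    ffState_dependsOnPast B L t₁ u x y hxy
  ext j
  rw [rewardNoise, rewardNoise, ffActive, ffActive, h]

theorem arrivalNoise_dependsOnPast (B : Fin m → ℝ) (L : ℝ) (t₁ : ℕ) (k : Fin n) (u : ℕ) :
    DependsOnPast (arrivalNoise r A lam B L t₁ k u) (t₁ + u) := by
  intro x y hxy
  have h : ffState r A B L t₁ x u = ffState r A B L t₁ y u :=
    ffState_dependsOnPast B L t₁ u x y hxy
  ext j
  rw [arrivalNoise, arrivalNoise, ffActive, ffActive, h]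

theorem sum_mul_sub_mean {f : Fin n → ℝ} (hlam1 : ∑ j, lam j = 1) (a : ℝ) :
    ∑ j, lam j * (a * (f j - ∑ k, lam k * f k)) = 0 := by
  set μ := ∑ k, lam k * f k with hμ
  have h : ∀ j, lam j * (a * (f j - μ)) = a * (lam j * f j) - lam j * (a * μ) := fun j => by ring
  simp only [h, Finset.sum_sub_distrib]
  rw [← Finset.mul_sum, ← Finset.sum_mul, hlam1, ← hμ, one_mul, sub_self]

theorem abs_mul_sub_mean_le {f : Fin n → ℝ} {a c : ℝ} (hlam0 : ∀ j, 0 ≤ lam j)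
    (hlam1 : ∑ j, lam j = 1) (ha0 : 0 ≤ a) (ha1 : a ≤ 1) (hf0 : ∀ j, 0 ≤ f j)
    (hfc : ∀ j, f j ≤ c) (j : Fin n) : |a * (f j - ∑ k, lam k * f k)| ≤ c := by
  have h1 : 0 ≤ ∑ k, lam k * f k := Finset.sum_nonneg fun k _ => mul_nonneg (hlam0 k) (hf0 k)
  have h2 : ∑ k, lam k * f k ≤ c := by
    calc ∑ k, lam k * f k ≤ ∑ k, lam k * c :=
          Finset.sum_le_sum fun k _ => mul_le_mul_of_nonneg_left (hfc k) (hlam0 k)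
      _ = c := by rw [← Finset.sum_mul, hlam1, one_mul]
  rw [abs_mul, abs_of_nonneg ha0]
  have h3 : |f j - ∑ k, lam k * f k| ≤ c := by
    rw [abs_le]; constructor <;> linarith [hf0 j, hfc j]
  exact (mul_le_of_le_one_left (abs_nonneg _) ha1).trans h3

/-- Prices are nonnegative, so surpluses lie between `0` and `∑ j, r j`; the added `1` covers the
arrival indicators. A union bound over one reward sum and `n` arrival sums gives the factor `n + 1`.
-/
theorem measure_not_ffQuiet_le [IsProbabilityMeasure P]
    (hXm : ∀ t, Measurable (X t)) (hXi : iIndepFun X P)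
    (hXl : ∀ t j, P.real {ω | X t ω = j} = lam j) (hlam0 : ∀ j, 0 ≤ lam j)
    (hlam1 : ∑ j, lam j = 1) (hr : ∀ j, 0 ≤ r j) (hA : ∀ i j, 0 ≤ A i j) {B : Fin m → ℝ} {L : ℝ}
    (hM : 0 ≤ thetaBar r A B) (t₁ : ℕ) {N : ℕ} {V δ : ℝ} (hV : 0 < V)
    (hNV : (1 + ∑ j, r j) ^ 2 * N ≤ V) (hδ : 0 ≤ δ) :
    P.real {ω | ¬ FFQuiet r A lam B L t₁ (fun t => X t ω) N δ}
      ≤ (n + 1) * Real.exp (-(δ ^ 2 / (2 * V))) := by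
  have hR : 0 ≤ ∑ j, r j := Finset.sum_nonneg fun j _ => hr j
  have hc : 0 < 1 + ∑ j, r j := by linarith
  have hreward := measure_sum_ge_le hXm hXi hXl hlam0 hlam1 (t₀ := t₁)
    (H := fun u x j => -rewardNoise r A lam B L t₁ u x j)
    (fun u x y hxy => by simp only [rewardNoise_dependsOnPast B L t₁ u x y hxy]) hc
    (fun u x => by
      simp only [mul_neg, Finset.sum_neg_distrib, neg_eq_zero, rewardNoise]
      exact sum_mul_sub_mean hlam1 _)
    (fun u x j => by
      rw [abs_neg, rewardNoise]
      refine abs_mul_sub_mean_le (f := fun j => max 0 (redCost r A _ j)) hlam0 hlam1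
        (ffActive_nonneg r A B L t₁ x u) (ffActive_le_one r A B L t₁ x u)
        (fun k => le_max_left _ _) (fun k => max_le hc.le ?_) j
      have h1 : r k ≤ ∑ j, r j := Finset.single_le_sum (fun j _ => hr j) (Finset.mem_univ k)
      have h2 : 0 ≤ ∑ i, (ffState r A B L t₁ x u).price i * A i k := Finset.sum_nonneg
        fun i _ => mul_nonneg (ffState_price_mem L t₁ x hM u i).1 (hA i k)
      rw [redCost]
      linarith) hV hNV hδ
  have harrival : ∀ k, P.real {ω | δ ≤ ∑ u ∈ Finset.range N,
      arrivalNoise r A lam B L t₁ k u (fun t => X t ω) (X (t₁ + u) ω)}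
        ≤ Real.exp (-(δ ^ 2 / (2 * V))) := fun k => by
    have hk : ∑ j, lam j * (if j = k then 1 else 0) = lam k := by simp
    refine measure_sum_ge_le hXm hXi hXl hlam0 hlam1 (t₀ := t₁)
      (H := arrivalNoise r A lam B L t₁ k) (arrivalNoise_dependsOnPast B L t₁ k) hc
      (fun u x => ?_) (fun u x j => ?_) hV hNV hδ
    · simp only [arrivalNoise]
      conv_lhs => rw [← hk]
      exact sum_mul_sub_mean hlam1 _
    · simp only [arrivalNoise]
      conv_lhs => rw [← hk]
      refine abs_mul_sub_mean_le (f := fun j => if j = k then 1 else 0) hlam0 hlam1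
        (ffActive_nonneg r A B L t₁ x u)
        (ffActive_le_one r A B L t₁ x u) (fun l => ?_) (fun l => ?_) j <;>
      split_ifs <;> linarith
  have hsub : {ω | ¬ FFQuiet r A lam B L t₁ (fun t => X t ω) N δ}
      ⊆ {ω | δ ≤ ∑ u ∈ Finset.range N,
          -rewardNoise r A lam B L t₁ u (fun t => X t ω) (X (t₁ + u) ω)}
        ∪ ⋃ k, {ω | δ ≤ ∑ u ∈ Finset.range N,
          arrivalNoise r A lam B L t₁ k u (fun t => X t ω) (X (t₁ + u) ω)} := by
    intro ω hω
    by_contra hc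
    simp only [Set.mem_union, Set.mem_iUnion, Set.mem_ofPred_eq, not_or, not_exists, not_le] at hc
    refine hω ⟨?_, fun k => (hc.2 k).le⟩
    have := hc.1
    rw [Finset.sum_neg_distrib] at this
    linarith
  refine (measureReal_mono hsub).trans ((measureReal_union_le _ _).trans ?_)
  have h2 := (measureReal_iUnion_fintype_le (μ := P) _).trans
    (Finset.sum_le_sum fun k (_ : k ∈ Finset.univ) => harrival k)
  simp only [Finset.sum_const, Finset.card_univ, Fintype.card_fin, nsmul_eq_mul] at h2
  linarith

theorem measure_not_arrivals_le [IsProbabilityMeasure P]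
    (hXm : ∀ t, Measurable (X t)) (hXi : iIndepFun X P)
    (hXl : ∀ t j, P.real {ω | X t ω = j} = lam j) (hlam0 : ∀ j, 0 ≤ lam j)
    (hlam1 : ∑ j, lam j = 1) (t₁ : ℕ) {N : ℕ} {V δ : ℝ} (hV : 0 < V) (hNV : N ≤ V) (hδ : 0 ≤ δ) :
    P.real {ω | ¬ ∀ j, |∑ u ∈ Finset.range N, ((if X (t₁ + u) ω = j then 1 else 0) - lam j)| ≤ δ}
      ≤ 2 * n * Real.exp (-(δ ^ 2 / (2 * V))) := by
  have hk : ∀ k, ∑ j, lam j * (if j = k then 1 else 0) = lam k := fun k => by simp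
  have hside : ∀ (σ : ℝ), |σ| = 1 → ∀ k, P.real {ω | δ ≤ ∑ u ∈ Finset.range N,
      σ * ((if X (t₁ + u) ω = k then 1 else 0) - lam k)} ≤ Real.exp (-(δ ^ 2 / (2 * V))) := by
    intro σ hσ k
    refine measure_sum_ge_le hXm hXi hXl hlam0 hlam1 (t₀ := t₁) (c := 1)
      (H := fun _ _ j => σ * ((if j = k then 1 else 0) - lam k)) (fun u x y _ => rfl) one_pos
      (fun u x => ?_) (fun u x j => ?_) hV (by simpa using hNV) hδ
    · conv_lhs => rw [← hk k]
      exact sum_mul_sub_mean hlam1 _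
    · rw [abs_mul, hσ, ← abs_one, ← abs_mul]
      conv_lhs => rw [← hk k]
      rw [abs_one]
      refine abs_mul_sub_mean_le (f := fun j => if j = k then 1 else 0) hlam0 hlam1
        zero_le_one le_rfl (fun l => ?_) (fun l => ?_) j <;>
      split_ifs <;> norm_num
  have hsub : {ω | ¬ ∀ j, |∑ u ∈ Finset.range N,
        ((if X (t₁ + u) ω = j then 1 else 0) - lam j)| ≤ δ}
      ⊆ (⋃ k, {ω | δ ≤ ∑ u ∈ Finset.range N,
          1 * ((if X (t₁ + u) ω = k then 1 else 0) - lam k)})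
        ∪ ⋃ k, {ω | δ ≤ ∑ u ∈ Finset.range N,
          -1 * ((if X (t₁ + u) ω = k then 1 else 0) - lam k)} := by
    intro ω hω
    by_contra hc
    simp only [Set.mem_union, Set.mem_iUnion, Set.mem_ofPred_eq, not_or, not_exists, not_le,
      ← Finset.mul_sum] at hc
    refine hω fun j => abs_le.2 ⟨?_, ?_⟩
    · linarith [hc.2 j]
    · linarith [hc.1 j]
  refine (measureReal_mono hsub).trans ((measureReal_union_le _ _).trans ?_)
  have h1 := (measureReal_iUnion_fintype_le (μ := P) _).trans
    (Finset.sum_le_sum fun k (_ : k ∈ Finset.univ) => hside 1 (by simp) k)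
  have h2 := (measureReal_iUnion_fintype_le (μ := P) _).trans
    (Finset.sum_le_sum fun k (_ : k ∈ Finset.univ) => hside (-1) (by simp) k)
  simp only [Finset.sum_const, Finset.card_univ, Fintype.card_fin, nsmul_eq_mul] at h1 h2
  linarith

theorem measure_exists_null_arrival [IsProbabilityMeasure P]
    (hXl : ∀ t j, P.real {ω | X t ω = j} = lam j) :
    P.real {ω | ¬ ∀ j, lam j = 0 → ∀ t, X t ω ≠ j} = 0 := by
  have h : P (⋃ j : Fin n, ⋃ t : ℕ, ⋃ _ : lam j = 0, {ω | X t ω = j}) = 0 := by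
    simp only [measure_iUnion_null_iff]
    intro j t hj
    have := hXl t j
    rwa [hj, measureReal_eq_zero_iff] at this
  rw [measureReal_eq_zero_iff]
  refine measure_mono_null (fun ω hω => ?_) h
  simp only [Set.mem_ofPred_eq, not_forall, not_not] at hω
  obtain ⟨j, hj, t, ht⟩ := hω
  simp only [Set.mem_iUnion]
  exact ⟨j, t, hj, ht⟩

theorem lam_nonneg (hXl : ∀ t j, P.real {ω | X t ω = j} = lam j) (j : Fin n) : 0 ≤ lam j := by
  rw [← hXl 0]; exact measureReal_nonneg

theorem sum_lam [IsProbabilityMeasure P]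
    (hXm : ∀ t, Measurable (X t)) (hXl : ∀ t j, P.real {ω | X t ω = j} = lam j) :
    ∑ j, lam j = 1 := by
  have h := sum_measureReal_preimage_singleton (μ := P) Finset.univ (f := X 0)
    fun j _ => hXm 0 (measurableSet_singleton j)
  simp only [Finset.coe_univ, Set.preimage_univ, probReal_univ] at h
  rw [← h]
  exact Finset.sum_congr rfl fun j _ => (hXl 0 j).symm

end NRM

/-! ### Lengths of the phases -/

namespace NRM

section Lengths

variable {T : ℕ} {α β γ ε : ℝ}

theorem rpow_le_len1 (T : ℕ) (α : ℝ) : (T : ℝ) ^ α ≤ len1 T α := Nat.le_ceil _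

theorem len1_lt (T : ℕ) (α : ℝ) : (len1 T α : ℝ) < (T : ℝ) ^ α + 1 :=
  Nat.ceil_lt_add_one (by positivity)

theorem len1_pos (hT : 4 ≤ T) : 0 < len1 T α :=
  Nat.ceil_pos.2 (Real.rpow_pos_of_pos (by positivity) _)

theorem two_le_sqrt (hT : 4 ≤ T) : 2 ≤ (T : ℝ) ^ (1 / 2 : ℝ) := by
  rw [← Real.sqrt_eq_rpow]
  exact Real.le_sqrt_of_sq_le (by norm_num; exact_mod_cast hT)

theorem len1_lt_self (hT : 4 ≤ T) (hα : α < 1 / 2) : len1 T α < T := by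
  have hT1 : (1 : ℝ) ≤ T := by exact_mod_cast (by omega : 1 ≤ T)
  have h1 := two_le_sqrt hT
  have h2 : (T : ℝ) ^ α ≤ (T : ℝ) ^ (1 / 2 : ℝ) := Real.rpow_le_rpow_of_exponent_le hT1 hα.le
  have h3 : (T : ℝ) ^ (1 / 2 : ℝ) * (T : ℝ) ^ (1 / 2 : ℝ) = T := by
    rw [← Real.rpow_add (by linarith)]; norm_num
  have h4 : (len1 T α : ℝ) < T := by nlinarith [len1_lt T α]
  exact_mod_cast h4

/-- The length of phase III is of larger order than the noise of phase II. -/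
theorem mul_le_remaining {D : ℝ} (hT : 4 ≤ T) (hα : α < 1 / 2) (hβ : α / 2 ≤ β)
    (hγ : γ < α / 2) (hε0 : 0 < ε)
    (hD : D + 2 ≤ (T : ℝ) ^ (γ - ε / 2)) :
    D * (T : ℝ) ^ (1 / 2 + ε / 2) ≤ (T : ℝ) - len1 T α - len2 T α β := by
  have hT1 : (1 : ℝ) ≤ T := by exact_mod_cast (by omega : 1 ≤ T)
  have hT0 : (0 : ℝ) < T := by linarith
  set S : ℝ := (T : ℝ) ^ (1 / 2 + ε / 2) with hS
  have hS1 : 1 ≤ S := Real.one_le_rpow hT1 (by linarith)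
  -- The spare `2 * S` pays for the roundings of the two lengths and, when phase II is empty, for
  -- `T^α`.
  have hprod : D * S + 2 * S ≤ (T : ℝ) ^ (1 / 2 + γ) := by
    have : (T : ℝ) ^ (1 / 2 + γ) = (T : ℝ) ^ (γ - ε / 2) * S := by
      rw [hS, ← Real.rpow_add hT0]; ring_nf
    rw [this, ← add_mul]
    exact mul_le_mul_of_nonneg_right hD (by linarith)
  have hα' : (T : ℝ) ^ α ≤ S := Real.rpow_le_rpow_of_exponent_le hT1 (by linarith)
  have hb : (T : ℝ) ^ (1 / 2 + γ) ≤ (T : ℝ) ^ (1 / 2 + β) :=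
    Real.rpow_le_rpow_of_exponent_le hT1 (by linarith)
  have h1 : (T : ℝ) ^ (1 / 2 + γ) ≤ T := by
    calc (T : ℝ) ^ (1 / 2 + γ) ≤ (T : ℝ) ^ (1 : ℝ) :=
          Real.rpow_le_rpow_of_exponent_le hT1 (by linarith)
      _ = T := Real.rpow_one _
  have hl1 := len1_lt T α
  rcases le_or_gt ((T : ℝ) - (T : ℝ) ^ α - (T : ℝ) ^ (1 / 2 + β)) 0 with h | h
  · have : len2 T α β = 0 := Nat.ceil_eq_zero.2 h
    rw [this]
    push_cast
    linarith
  · have : (len2 T α β : ℝ) < (T : ℝ) - (T : ℝ) ^ α - (T : ℝ) ^ (1 / 2 + β) + 1 :=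
      Nat.ceil_lt_add_one h.le
    linarith

end Lengths

end NRM

/-! ### The probability estimate -/

set_option maxHeartbeats 1000000 in
open NRM in
theorem lemma4 {m n : ℕ} (r : Fin n → ℝ) (A : Matrix (Fin m) (Fin n) ℝ) (lam : Fin n → ℝ)
    -- nonnegative revenues and consumptions; every type consumes some resource
    (hr : ∀ j, 0 ≤ r j) (hA : ∀ i j, 0 ≤ A i j) (hA' : ∀ j, ∃ i, A i j ≠ 0)
    (hgp : NRM.GeneralPosition r A)
    -- unscaled horizon and capacities; the `k`-th system has `T = k * Tbar`, `C = k * Cbar`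
    (Tbar : ℕ) (hT : 0 < Tbar) (Cbar : Fin m → ℝ) (hC : ∀ i, 0 < Cbar i)
    -- independent arrivals, of type `j` with probability `lam j`
    {Ω : Type*} [MeasurableSpace Ω] (P : Measure Ω) [IsProbabilityMeasure P]
    (X : ℕ → Ω → Fin n) (hXm : ∀ t, Measurable (X t)) (hXi : iIndepFun X P)
    (hXl : ∀ t j, P.real {ω | X t ω = j} = lam j)
    -- parameters, which may depend on the system
    (α β γ ε : ℕ → ℝ)
    (hpar : ∀ᶠ k : ℕ in atTop, 0 < α k ∧ α k < 1 / 2 ∧ α k / 2 ≤ β k ∧ β k < 1 / 2 ∧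
      0 < γ k ∧ γ k < α k / 2)
    (hε : ∀ᶠ k : ℕ in atTop, 0 < ε k ∧ ε k < 2 * γ k ∧
      Real.log (Real.log ((k * Tbar : ℕ) : ℝ)) / Real.log ((k * Tbar : ℕ) : ℝ) ≤ ε k)
    -- the two strict inequalities `ε < 2γ < α` survive in the limit, on the scale of powers
    -- of `T` (automatic for parameters that do not depend on the system)
    (hgap₁ : Tendsto (fun k : ℕ => ((k * Tbar : ℕ) : ℝ) ^ (2 * γ k - ε k)) atTop atTop)
    (hgap₂ : Tendsto (fun k : ℕ => ((k * Tbar : ℕ) : ℝ) ^ (α k - 2 * γ k)) atTop atTop)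
    -- optimal solutions of the hindsight programs `HO(t₁')`
    (zbar : ℕ → Ω → Fin n → ℝ)
    (hz : ∀ᶠ k : ℕ in atTop, ∀ ω, NRM.IsHindsightOptimal r A (fun i => k * Cbar i) (k * Tbar)
      (α k) (fun t => X t ω) (zbar k ω)) :
    (fun k : ℕ => P.real {ω | NRM.GoodPath r A lam (fun i => k * Cbar i) (k * Tbar)
        (α k) (β k) (γ k) (fun t => X t ω) (zbar k ω)}ᶜ)
      =O[atTop] fun k : ℕ => Real.exp (-((k * Tbar : ℕ) : ℝ) ^ ε k) := by
  have hlam0 := lam_nonneg hXl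
  have hlam1 := sum_lam hXm hXl
  have hlamle : ∀ j, lam j ≤ 1 := fun j => by
    rw [← hlam1]; exact Finset.single_le_sum (fun j _ => hlam0 j) (Finset.mem_univ j)
  obtain ⟨j₀⟩ : Nonempty (Fin n) := by
    rcases n with - | n
    · simp at hlam1
    · infer_instance
  obtain ⟨i₀, hi₀⟩ := hA' j₀
  have : NeZero m := ⟨by rintro rfl; exact i₀.elim0⟩
  have hrpos := hgp.pos hr
  have hTbar : (0 : ℝ) < Tbar := by exact_mod_cast hT
  set b : Fin m → ℝ := fun i => Cbar i / Tbar with hb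
  have hbpos : ∀ i, 0 < b i := fun i => div_pos (hC i) hTbar
  have hM : 0 < thetaBar r A b :=
    (alphaBar_pos hrpos hA hi₀).trans_le (alphaBar_le_thetaBar hr hA hbpos i₀)
  obtain ⟨p, ξ, hpair⟩ := exists_fluidPair (A := A) hr hA hlam0 hbpos
  obtain ⟨K, κ, hK, hκ, hgood⟩ := hpair.exists_goodPath hrpos hA hA' hbpos hgp hM hlamle
  set c : ℝ := 1 + ∑ j, r j with hcdef
  have hc1 : 1 ≤ c := le_add_of_nonneg_right (Finset.sum_nonneg fun j _ => hr j)
  have hTtop : Tendsto (fun k : ℕ => k * Tbar) atTop atTop := tendsto_id.atTop_mul_const' hT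
  -- The noise scales carry half exponents: what is needed is that `T^(γ-ε/2)` and `T^(α/2-γ)`
  -- diverge.
  have hsqrt : ∀ {f : ℕ → ℝ}, Tendsto (fun k : ℕ => ((k * Tbar : ℕ) : ℝ) ^ f k) atTop atTop →
      Tendsto (fun k : ℕ => ((k * Tbar : ℕ) : ℝ) ^ (f k / 2)) atTop atTop := by
    intro f hf
    refine ((tendsto_rpow_atTop (half_pos one_pos)).comp hf).congr fun k => ?_
    rw [Function.comp_apply, ← Real.rpow_mul (Nat.cast_nonneg _)]
    ring_nf
  -- Two runs of `FF` contribute `n + 1` each, and two arrival counts `2 * n` each.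
  refine IsBigO.of_bound (2 * (n + 1) + 4 * n) ?_
  filter_upwards [hpar, hε, hz, hTtop.eventually_ge_atTop 4,
    (hsqrt hgap₁).eventually_ge_atTop (2 * c * K / κ + 2),
    (hsqrt hgap₂).eventually_ge_atTop ((κ + 2) / κ)] with k hpark hεk hzk hT4 hG1 hG2
  obtain ⟨hα0, hα1, hβ0, hβ1, hγ0, hγ1⟩ := hpark
  obtain ⟨hε0, hε1, -⟩ := hεk
  generalize α k = a at *
  generalize β k = bb at *
  generalize γ k = g at *
  generalize ε k = e at *
  set T : ℕ := k * Tbar with hTdef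
  have hCT : ∀ i, (k : ℝ) * Cbar i = T * b i := fun i => by
    rw [hb, hTdef]; push_cast; field_simp
  have hT1 : (1 : ℝ) ≤ T := by exact_mod_cast (by omega : 1 ≤ T)
  have hT0 : (0 : ℝ) < T := by linarith
  have hG1' : 2 * c * K / κ + 2 ≤ (T : ℝ) ^ (g - e / 2) := by
    convert! hG1 using 2; ring
  have hG2' : (κ + 2) / κ ≤ (T : ℝ) ^ (a / 2 - g) := by
    convert! hG2 using 2; ring
  set l1 := len1 T a with hl1
  set l2 := len2 T a bb with hl2
  -- Since `l1 ≤ 2 * T^a`, the variance proxy is `2 * c ^ 2 * T^a`, and the factor `2 * c` makes the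
  -- Azuma exponent exactly `T^e`. For `δ₂`, with proxy `c ^ 2 * T`, it is `2 * T^e`.
  set δ₁ : ℝ := 2 * c * (T : ℝ) ^ (a / 2 + e / 2) with hδ₁
  set δ₂ : ℝ := 2 * c * (T : ℝ) ^ (1 / 2 + e / 2) with hδ₂
  have hTa1 : 1 ≤ (T : ℝ) ^ a := Real.one_le_rpow hT1 hα0.le
  have hl1pos : 0 < l1 := len1_pos hT4
  have hl1lt : l1 < T := len1_lt_self hT4 hα1
  have hl1le : (l1 : ℝ) ≤ (T : ℝ) ^ a + 1 := (len1_lt T a).le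
  have hrem := mul_le_remaining hT4 hα1 hβ0 hγ1 hε0 hG1'
  have hl12' : (l1 : ℝ) + l2 ≤ T := by
    have : 0 ≤ 2 * c * K / κ * (T : ℝ) ^ (1 / 2 + e / 2) := by positivity
    linarith
  have hl12 : l1 + l2 ≤ T := by exact_mod_cast hl12'
  have hδ₁1 : 1 ≤ δ₁ := by
    have := Real.one_le_rpow hT1 (by linarith : 0 ≤ a / 2 + e / 2)
    exact one_le_mul_of_one_le_of_one_le (by linarith) this
  have hδ₂1 : 1 ≤ δ₂ := by
    have := Real.one_le_rpow hT1 (by linarith : 0 ≤ 1 / 2 + e / 2)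
    exact one_le_mul_of_one_le_of_one_le (by linarith) this
  have hsq₁ : δ₁ ^ 2 = 4 * c ^ 2 * ((T : ℝ) ^ a * (T : ℝ) ^ e) := by
    rw [hδ₁, mul_pow, ← Real.rpow_natCast, ← Real.rpow_natCast (_ ^ _), ← Real.rpow_mul hT0.le,
      ← Real.rpow_add hT0, Real.rpow_natCast]
    push_cast; ring_nf
  have hsq₂ : δ₂ ^ 2 = 4 * c ^ 2 * (T * (T : ℝ) ^ e) := by
    have : (T : ℝ) * (T : ℝ) ^ e = (T : ℝ) ^ (1 + e) := by
      rw [Real.rpow_add hT0, Real.rpow_one]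
    rw [this, hδ₂, mul_pow, ← Real.rpow_natCast, ← Real.rpow_natCast (_ ^ _),
      ← Real.rpow_mul hT0.le, Real.rpow_natCast]
    push_cast; ring_nf
  have hTe1 : 1 ≤ (T : ℝ) ^ e := Real.one_le_rpow hT1 hε0.le
  have hc2 : 1 ≤ c ^ 2 := one_le_pow₀ hc1
  have hs1 : √(l1 : ℝ) ≤ δ₁ := by
    rw [Real.sqrt_le_left (by linarith), hsq₁]
    have e1 : (T : ℝ) ^ a ≤ (T : ℝ) ^ a * (T : ℝ) ^ e := le_mul_of_one_le_right (by linarith) hTe1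
    have e2 := mul_le_mul hc2 e1 (by linarith) (by linarith)
    linarith
  have hTTe : (T : ℝ) ≤ T * (T : ℝ) ^ e := le_mul_of_one_le_right hT0.le hTe1
  have hs2 : √(l2 : ℝ) ≤ δ₂ := by
    rw [Real.sqrt_le_left (by linarith), hsq₂]
    have e1 : (l2 : ℝ) ≤ T := by exact_mod_cast (by omega : l2 ≤ T)
    have e2 := mul_le_mul hc2 hTTe hT0.le (by linarith)
    linarith
  have hTc1 : 1 ≤ (T : ℝ) ^ (a / 2 + g) := Real.one_le_rpow hT1 (by linarith)
  have hn1 : K * δ₁ < κ * (T : ℝ) ^ (a / 2 + g) := by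
    have e1 : (T : ℝ) ^ (a / 2 + g) = (T : ℝ) ^ (a / 2 + e / 2) * (T : ℝ) ^ (g - e / 2) := by
      rw [← Real.rpow_add hT0]; ring_nf
    have e2 : 2 * c * K < κ * (T : ℝ) ^ (g - e / 2) := by
      have : 2 * c * K / κ < (T : ℝ) ^ (g - e / 2) := by linarith
      rw [div_lt_iff₀ hκ] at this
      linarith
    have e3 : 0 < (T : ℝ) ^ (a / 2 + e / 2) := by positivity
    have e4 := mul_lt_mul_of_pos_left e2 e3
    rw [e1, hδ₁]
    linarith
  have hn2 : 1 + K * δ₁ + (T : ℝ) ^ (a / 2 + g) ≤ κ * (T : ℝ) ^ a := by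
    have e1 : (T : ℝ) ^ a = (T : ℝ) ^ (a / 2 + g) * (T : ℝ) ^ (a / 2 - g) := by
      rw [← Real.rpow_add hT0]; ring_nf
    rw [div_le_iff₀ hκ] at hG2'
    have := mul_le_mul_of_nonneg_left hG2' (by linarith : 0 ≤ (T : ℝ) ^ (a / 2 + g))
    rw [e1]
    linarith
  have hn3 : K * δ₂ ≤ κ * ((T : ℝ) - l1 - l2) := by
    have := mul_le_mul_of_nonneg_left hrem hκ.le
    refine le_trans (le_of_eq ?_) this
    rw [hδ₂]; field_simp
  have hV1 : c ^ 2 * (l1 : ℝ) ≤ 2 * c ^ 2 * (T : ℝ) ^ a := by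
    have := mul_le_mul_of_nonneg_left (by linarith : (l1 : ℝ) ≤ 2 * (T : ℝ) ^ a)
      (by linarith : 0 ≤ c ^ 2)
    linarith
  have hV2 : ∀ N : ℕ, N ≤ T → c ^ 2 * (N : ℝ) ≤ c ^ 2 * T := fun N hN => by
    have : (N : ℝ) ≤ T := by exact_mod_cast hN
    exact mul_le_mul_of_nonneg_left this (by linarith)
  have hE1 : Real.exp (-(δ₁ ^ 2 / (2 * (2 * c ^ 2 * (T : ℝ) ^ a)))) ≤ Real.exp (-(T : ℝ) ^ e) := by
    rw [Real.exp_le_exp, neg_le_neg_iff, hsq₁, le_div_iff₀ (by positivity)]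
    exact le_of_eq (by ring)
  have hE2 : Real.exp (-(δ₂ ^ 2 / (2 * (c ^ 2 * (T : ℝ))))) ≤ Real.exp (-(T : ℝ) ^ e) := by
    rw [Real.exp_le_exp, neg_le_neg_iff, hsq₂, le_div_iff₀ (by positivity)]
    have : 0 ≤ c ^ 2 * (T * (T : ℝ) ^ e) := by positivity
    linarith
  have hL2 : (0 : ℝ) < T - l1 := sub_pos.2 (by exact_mod_cast hl1lt)
  have hP1 := measure_not_ffQuiet_le hXm hXi hXl hlam0 hlam1 hr hA
    (B := fun i => (l1 : ℝ) * b i) (L := l1)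
    (by rw [thetaBar_smul (by exact_mod_cast hl1pos)]; exact hM.le) 1 (by positivity) hV1
    (by linarith : 0 ≤ δ₁)
  have hP2 := measure_not_ffQuiet_le hXm hXi hXl hlam0 hlam1 hr hA
    (B := fun i => ((T : ℝ) - l1) * b i) (L := (T : ℝ) - l1)
    (by rw [thetaBar_smul hL2]; exact hM.le) (l1 + 1) (by positivity)
    (hV2 l2 (by omega)) (by linarith : 0 ≤ δ₂)
  have hVarr : ∀ N : ℕ, N ≤ T → (N : ℝ) ≤ c ^ 2 * T := fun N hN =>
    (le_mul_of_one_le_left (Nat.cast_nonneg N) hc2).trans (hV2 N hN)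
  have hP3 := measure_not_arrivals_le hXm hXi hXl hlam0 hlam1 (l1 + 1) (by positivity)
    (hVarr (T - l1) (Nat.sub_le _ _)) (by linarith : 0 ≤ δ₂)
  have hP4 := measure_not_arrivals_le hXm hXi hXl hlam0 hlam1 (l1 + 1) (by positivity)
    (hVarr l2 (by omega)) (by linarith : 0 ≤ δ₂)
  have hP5 := measure_exists_null_arrival hXl
  rw [Real.norm_of_nonneg measureReal_nonneg, Real.norm_of_nonneg (Real.exp_pos _).le]
  refine (measureReal_mono (s₂ := {ω | ¬ FFQuiet r A lam
      (fun i => (l1 : ℝ) * b i) l1 1 (fun t => X t ω) l1 δ₁} ∪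
      ({ω | ¬ FFQuiet r A lam (fun i => ((T : ℝ) - l1) * b i)
      ((T : ℝ) - l1) (l1 + 1) (fun t => X t ω) l2 δ₂} ∪
      ({ω | ¬ ∀ j, |∑ u ∈ Finset.range (T - l1),
        ((if X (l1 + 1 + u) ω = j then 1 else 0) - lam j)| ≤ δ₂} ∪
      ({ω | ¬ ∀ j, |∑ u ∈ Finset.range l2,
        ((if X (l1 + 1 + u) ω = j then 1 else 0) - lam j)| ≤ δ₂} ∪
      {ω | ¬ ∀ j, lam j = 0 → ∀ t, X t ω ≠ j})))) fun ω hω => ?_).trans ?_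
  · by_contra hc
    simp only [Set.mem_union, Set.mem_ofPred_eq, not_or, not_not] at hc
    obtain ⟨h1, h2, h3, h4, h5⟩ := hc
    exact hω (hgood _ T a bb g δ₁ δ₂ (fun t => X t ω) (zbar k ω) hCT (by omega) hl1pos hl1lt hl12
      (rpow_le_len1 T a) hl1le hs1 hδ₁1 hs2 hδ₂1 hn1 hn2 hn3 h1 h2 h3 h4 h5 (hzk ω))
  · refine (measureReal_union_le _ _).trans ?_
    refine (add_le_add_right ((measureReal_union_le _ _).trans (add_le_add_right
      ((measureReal_union_le _ _).trans (add_le_add_right (measureReal_union_le _ _) _)) _))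
      _).trans ?_
    have hn0 : (0 : ℝ) ≤ n := Nat.cast_nonneg n
    have f1 := mul_le_mul_of_nonneg_left hE1 (by linarith : (0 : ℝ) ≤ n + 1)
    have f2 := mul_le_mul_of_nonneg_left hE2 (by linarith : (0 : ℝ) ≤ n + 1)
    have f3 := mul_le_mul_of_nonneg_left hE2 (by linarith : (0 : ℝ) ≤ 2 * n)
    linarith
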